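/- A tensor in $\mathbb{R}^{c\times n}$ has $c$ channels of length $n$. A one-dimensional convolutional neural network (CNN) is a finite chain of 1D convolutional layers (cross-correlations with a grouping number $g$, kernel size, stride, dilation, bias and activation), transposed 1D convolutional layers, and reshaping operations (rearrangements of the entries of a tensor). It is linear if no layer has an activation or a bias. Its number of layers includes the reshaping operations, and its active weights are the nonzero weights and biases of its (transposed) convolutional layers. A vector $\mathbf z\in\mathbb{C}^{p}$ is fed to a network through the embedding $\mathbb{C}^p\hookrightarrow\mathbb{R}^{4\times p}$, $\mathbf z\mapsto[\operatorname{Re}\mathbf z,\operatorname{Im}\mathbf z,\operatorname{Re}\mathbf z,\operatorname{Im}\mathbf z]$. For an integer $s\ge 1$, $H^s(0,1)$ is the space of real functions on $(0,1)$ whose weak derivatives up to order $s$ are in $L^2$, with norm $\|f\|_{H^s}^2=\sum_{j\le s}\|f^{(j)}\|_{L^2}^2$; each such $f$ has a (unique) continuous representative on $[0,1]$, by which $f$ is evaluated pointwise. **Theorem.** There are a universal constant $C>0$, constants $c(s)>0$ depending only on $s$, and continuous linear maps $T=T_{s,m}:H^s(0,1)\to\mathbb{C}^{2m+1}$ depending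 only on $s$ and $m$, such that the following holds. Let $k\ge1$ be an integer, $h=2^{-k}$, $N_h=2^k+1$, and let $x_j=(j-1)h$, $j=1,\dots,N_h$, be the uniform grid of stepsize $h$ on $[0,1]$. For every integer $m\ge1$ there is a single linear CNN $\Psi:\mathbb{C}^{2m+1}\to\mathbb{R}^{N_h}$ with 1. at most $C\log(1/h)$ layers, 2. at most $C\,m\log(1/h)$ active weights, 3. at most $8m$ input channels and at most $8m$ output channels in each (transposed) convolutional layer, and kernels grouped by $m$: all (transposed) convolutional layers have grouping number $m$, with the exception of at most $C$ layers, each of which has at most $8$ output channels, such that for every integer $s\ge1$ and every $f\in H^s(0,1)$ $$\sup_{j=1,\dots,N_h}|f(x_j)-\Psi_j(T_{s,m}f)|\le c(s)\,m^{1/2-s}\,\|f\|_{H^s(0,1)}.$$ -/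

import Mathlib

open MeasureTheory Set
open scoped ContDiff

noncomputable section

/-! ### One-dimensional convolutional neural networks -/

/-- Real tensors with `c` channels of length `n`. -/
abbrev Tensor (c n : ℕ) : Type := Fin c → Fin n → ℝ

/-- The hyperparameters of a (transposed) one-dimensional convolutional layer. The numbers of
input and output channels are multiples of the grouping number; they are given through the number
of channels in each group. -/
structure LayerShape where
  groups : ℕ
  inPerGroup : ℕ
  outPerGroup : ℕ
  kernelSize : ℕ
  stride : ℕ
  dilation : ℕ
  groups_pos : 0 < groups
  inPerGroup_pos : 0 < inPerGroup
  outPerGroup_pos : 0 < outPerGroup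
  kernelSize_pos : 0 < kernelSize
  stride_pos : 0 < stride
  dilation_pos : 0 < dilation

namespace LayerShape

/-- Number of input channels. -/
def inCh (S : LayerShape) : ℕ := S.groups * S.inPerGroup

/-- Number of output channels. -/
def outCh (S : LayerShape) : ℕ := S.groups * S.outPerGroup

/-- The `a`-th input channel of the group to which the output channel `k` belongs. -/
def inputOf (S : LayerShape) (k : Fin S.outCh) (a : Fin S.inPerGroup) : Fin S.inCh :=
  finProdFinEquiv (Fin.divNat (m := S.groups) (n := S.outPerGroup) k, a)

/-- Output length `⌊(n - d (s - 1) - 1) / t + 1⌋` of a convolution acting on inputs of length `n`,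
with kernel size `s`, stride `t` and dilation `d`. It is only used when `d (s - 1) < n`. -/
def convLength (S : LayerShape) (n : ℕ) : ℕ :=
  (n - S.dilation * (S.kernelSize - 1) - 1) / S.stride + 1

/-- Output length `(n - 1) t + d (s - 1) + 1` of a transposed convolution acting on inputs of
length `n`. It is only used when `0 < n`. -/
def convTransposeLength (S : LayerShape) (n : ℕ) : ℕ :=
  (n - 1) * S.stride + S.dilation * (S.kernelSize - 1) + 1

theorem window_lt (S : LayerShape) {n : ℕ} (hn : S.dilation * (S.kernelSize - 1) < n)
    (j : Fin (S.convLength n)) (i : Fin S.kernelSize) :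
    (j : ℕ) * S.stride + (i : ℕ) * S.dilation < n := by
  have h1 : (j : ℕ) ≤ (n - S.dilation * (S.kernelSize - 1) - 1) / S.stride :=
    Nat.lt_succ_iff.mp j.isLt
  have h2 := (Nat.le_div_iff_mul_le S.stride_pos).mp h1
  have h3 : (i : ℕ) * S.dilation ≤ S.dilation * (S.kernelSize - 1) := by
    rw [Nat.mul_comm]
    exact Nat.mul_le_mul_left _ (by have := i.isLt; omega)
  omega

end LayerShape

/-- The parameters of a layer of shape `S` with output length `n'`: weights, biases and the
activation function. -/
structure LayerParams (S : LayerShape) (n' : ℕ) where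
  weight : Fin S.outCh → Fin S.inPerGroup → Fin S.kernelSize → ℝ
  bias : Tensor S.outCh n'
  activation : ℝ → ℝ

namespace LayerParams

variable {S : LayerShape} {n' : ℕ}

/-- The layer is linear: no activation and no bias. -/
def IsLinear (P : LayerParams S n') : Prop :=
  P.activation = id ∧ P.bias = 0

/-- Number of nonzero weights and biases. -/
def activeWeights (P : LayerParams S n') : ℕ :=
  Set.ncard {x : Fin S.outCh × Fin S.inPerGroup × Fin S.kernelSize |
      P.weight x.1 x.2.1 x.2.2 ≠ 0} +
    Set.ncard {x : Fin S.outCh × Fin n' | P.bias x.1 x.2 ≠ 0}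

/-- The action of a convolutional layer (grouped, strided, dilated cross-correlation). -/
def conv {n : ℕ} (P : LayerParams S (S.convLength n))
    (hn : S.dilation * (S.kernelSize - 1) < n) (X : Tensor S.inCh n) :
    Tensor S.outCh (S.convLength n) := fun k j =>
  P.activation
    ((∑ a : Fin S.inPerGroup, ∑ i : Fin S.kernelSize,
        P.weight k a i *
          X (S.inputOf k a) ⟨(j : ℕ) * S.stride + (i : ℕ) * S.dilation, S.window_lt hn j i⟩) +
      P.bias k j)

/-- The action of a transposed convolutional layer: the entry `l` of the input is spread, with the
weight `i` of the kernel, onto the entry `l t + i d` of the output. -/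
def convTranspose {n : ℕ} (P : LayerParams S (S.convTransposeLength n)) (X : Tensor S.inCh n) :
    Tensor S.outCh (S.convTransposeLength n) := fun k j =>
  P.activation
    ((∑ a : Fin S.inPerGroup, ∑ i : Fin S.kernelSize, ∑ l : Fin n,
        if (l : ℕ) * S.stride + (i : ℕ) * S.dilation = (j : ℕ) then
          P.weight k a i * X (S.inputOf k a) l else 0) +
      P.bias k j)

end LayerParams

/-- `CNN c n c' n'` is the type of one-dimensional convolutional neural networks with input in
`ℝ^{c × n}` and output in `ℝ^{c' × n'}`: finite chains of convolutional layers, transposed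
convolutional layers and reshaping operations. A reshaping only rearranges the entries of a tensor
(it neither drops, nor copies, nor changes any of them). -/
inductive CNN (c n : ℕ) : ℕ → ℕ → Type
  | nil : CNN c n c n
  | reshape {c₁ n₁ c₂ n₂ : ℕ} (N : CNN c n c₁ n₁) (e : Fin c₂ × Fin n₂ ≃ Fin c₁ × Fin n₁) :
      CNN c n c₂ n₂
  | conv {n₁ : ℕ} (S : LayerShape) (N : CNN c n S.inCh n₁)
      (hn : S.dilation * (S.kernelSize - 1) < n₁) (P : LayerParams S (S.convLength n₁)) :
      CNN c n S.outCh (S.convLength n₁)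
  | convTranspose {n₁ : ℕ} (S : LayerShape) (N : CNN c n S.inCh n₁)
      (hn : 0 < n₁) (P : LayerParams S (S.convTransposeLength n₁)) :
      CNN c n S.outCh (S.convTransposeLength n₁)

namespace CNN

variable {c n : ℕ}

/-- The map realized by a network. -/
def eval : {c' n' : ℕ} → CNN c n c' n' → Tensor c n → Tensor c' n'
  | _, _, nil, X => X
  | _, _, reshape N e, X => fun k j => N.eval X (e (k, j)).1 (e (k, j)).2
  | _, _, conv _ N hn P, X => P.conv hn (N.eval X)
  | _, _, convTranspose _ N _ P, X => P.convTranspose (N.eval X)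

/-- Number of layers; reshaping operations are counted, too. -/
def depth : {c' n' : ℕ} → CNN c n c' n' → ℕ
  | _, _, nil => 0
  | _, _, reshape N _ => N.depth + 1
  | _, _, conv _ N _ _ => N.depth + 1
  | _, _, convTranspose _ N _ _ => N.depth + 1

/-- Total number of nonzero weights and biases. -/
def activeWeights : {c' n' : ℕ} → CNN c n c' n' → ℕ
  | _, _, nil => 0
  | _, _, reshape N _ => N.activeWeights
  | _, _, conv _ N _ P => N.activeWeights + P.activeWeights
  | _, _, convTranspose _ N _ P => N.activeWeights + P.activeWeights

/-- The shapes of all (transposed) convolutional layers of the network, from the last one to the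
first one. -/
def convLayers : {c' n' : ℕ} → CNN c n c' n' → List LayerShape
  | _, _, nil => []
  | _, _, reshape N _ => N.convLayers
  | _, _, conv S N _ _ => S :: N.convLayers
  | _, _, convTranspose S N _ _ => S :: N.convLayers

/-- A network is linear if no layer has an activation or a bias. -/
def IsLinear : {c' n' : ℕ} → CNN c n c' n' → Prop
  | _, _, nil => True
  | _, _, reshape N _ => N.IsLinear
  | _, _, conv _ N _ P => N.IsLinear ∧ P.IsLinear
  | _, _, convTranspose _ N _ P => N.IsLinear ∧ P.IsLinear

end CNN

/-- The embedding `ℂ^p ↪ ℝ^{4 × p}`, `z ↦ [Re z, Im z, Re z, Im z]`, by which complex vectors are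
fed to a network. -/
def complexEmbed {p : ℕ} (z : Fin p → ℂ) : Tensor 4 p :=
  ![fun i => (z i).re, fun i => (z i).im, fun i => (z i).re, fun i => (z i).im]

/-! ### The Sobolev space `H^s(0,1)` -/

/-- Lebesgue measure on `Ω = (0,1)`. -/
abbrev volΩ : Measure ℝ := volume.restrict (Ioo (0 : ℝ) 1)

/-- `g` is the weak derivative of `u` on `(0,1)`: integration by parts holds against all smooth
functions with compact support in `(0,1)`. -/
def IsWeakDeriv (u g : Lp ℝ 2 volΩ) : Prop :=
  ∀ φ : ℝ → ℝ, ContDiff ℝ ∞ φ → HasCompactSupport φ → tsupport φ ⊆ Ioo (0 : ℝ) 1 →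
    ∫ x in Ioo (0 : ℝ) 1, u x * deriv φ x = -∫ x in Ioo (0 : ℝ) 1, g x * φ x

theorem integrable_Lp_mul (u : Lp ℝ 2 volΩ) {ψ : ℝ → ℝ} (h1 : Continuous ψ)
    (h2 : HasCompactSupport ψ) : Integrable (fun x => u x * ψ x) volΩ :=
  MemLp.integrable_mul (p := 2) (q := 2) (Lp.memLp u) (h1.memLp_of_hasCompactSupport h2)

theorem integral_Lp_add_mul (u v : Lp ℝ 2 volΩ) {ψ : ℝ → ℝ} (h1 : Continuous ψ)
    (h2 : HasCompactSupport ψ) :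
    ∫ x, (u + v : Lp ℝ 2 volΩ) x * ψ x ∂volΩ = ∫ x, u x * ψ x ∂volΩ + ∫ x, v x * ψ x ∂volΩ := by
  rw [← integral_add (integrable_Lp_mul u h1 h2) (integrable_Lp_mul v h1 h2)]
  refine integral_congr_ae ?_
  filter_upwards [Lp.coeFn_add u v] with x hx
  rw [hx, Pi.add_apply, add_mul]

theorem integral_Lp_smul_mul (a : ℝ) (u : Lp ℝ 2 volΩ) (ψ : ℝ → ℝ) :
    ∫ x, (a • u : Lp ℝ 2 volΩ) x * ψ x ∂volΩ = a * ∫ x, u x * ψ x ∂volΩ := by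
  rw [← integral_const_mul]
  refine integral_congr_ae ?_
  filter_upwards [Lp.coeFn_smul a u] with x hx
  rw [hx, Pi.smul_apply, smul_eq_mul, mul_assoc]

theorem IsWeakDeriv.add {u g v h : Lp ℝ 2 volΩ} (H1 : IsWeakDeriv u g) (H2 : IsWeakDeriv v h) :
    IsWeakDeriv (u + v) (g + h) := by
  intro φ h1 h2 h3
  have hd : Continuous (deriv φ) := h1.continuous_deriv (by simp)
  rw [integral_Lp_add_mul _ _ hd h2.deriv, integral_Lp_add_mul _ _ h1.continuous h2,
    H1 φ h1 h2 h3, H2 φ h1 h2 h3, neg_add]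

theorem IsWeakDeriv.smul {u g : Lp ℝ 2 volΩ} (a : ℝ) (H : IsWeakDeriv u g) :
    IsWeakDeriv (a • u) (a • g) := by
  intro φ h1 h2 h3
  rw [integral_Lp_smul_mul, integral_Lp_smul_mul, H φ h1 h2 h3, mul_neg]

/-- The Sobolev space `H^s(0,1)` of real functions, `s` a natural number. An element `f` is stored
with its (uniquely determined) weak derivatives, as the vector `(f, f', …, f^(s))` of `L²`
functions, and the norm is `‖f‖² = ∑_{j ≤ s} ‖f^(j)‖²_{L²}`. -/
def HSobolev (s : ℕ) : Submodule ℝ (PiLp 2 (fun _ : Fin (s + 1) => Lp ℝ 2 volΩ)) where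
  carrier := {F | ∀ j : Fin s, IsWeakDeriv (F j.castSucc) (F j.succ)}
  zero_mem' := by
    intro j
    have h := integral_Lp_smul_mul 0 0
    intro φ _ _ _
    have h1 := h (deriv φ)
    have h2 := h φ
    rw [zero_smul, zero_mul] at h1 h2
    change ∫ x, (0 : Lp ℝ 2 volΩ) x * deriv φ x ∂volΩ = -∫ x, (0 : Lp ℝ 2 volΩ) x * φ x ∂volΩ
    rw [h1, h2, neg_zero]
  add_mem' := fun h1 h2 j => (h1 j).add (h2 j)
  smul_mem' := fun a _ h j => (h j).smul a

/-- The underlying `L²` function of an element of `H^s(0,1)`. -/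
def HSobolev.toL2 {s : ℕ} (f : HSobolev s) : Lp ℝ 2 volΩ :=
  (f : PiLp 2 (fun _ : Fin (s + 1) => Lp ℝ 2 volΩ)) 0

end

/-!
A function `f ∈ H^s(0,1)` is extended to an `H^s` function on the interval `[-1/2, 3/2]`, multiplied
by a smooth cutoff `χ` that is `1` on `[0,1]`, and expanded in a Fourier series of period `2`. The
operator `T` returns the Fourier coefficients of frequency `0, 1, …, 2m`, and `Ψ` evaluates the
part of frequency less than `m` of the series on the grid. Since the function is real, negative
frequencies are accounted for by doubling the coefficients of positive frequency and taking the
real part.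

*Extension.* The top derivative `f^(s)` is extended by zero, and integrated `s` times from `0`. The
constants of integration are determined by the requirement that the mean value over `(0,1)` of the
primitive is that of `f^(j)`; they are continuous in `f` and, by the du Bois-Reymond lemma, they
yield `f^(j)` on `(0,1)` (`IsWeakDeriv.ae_eq_primitive`). Built from operators of `L²`, the
extension is a continuous linear map.

*Error.* If `F` is the primitive of `G`, then integration by parts yields
`iπn c_n(χF) = c_n(χ'F) + c_n(χG)`. By induction on `s`, over all cutoff functions at once, and
Parseval's identity in the base case, `∑ n^(2s) |c_n(χF)|² ≤ C ‖f‖²` (`exists_fourierCut_decay`).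
The tail `∑_{n ≥ m} |c_n|` is then at most a constant times `m^(1/2-s) ‖f‖`, by the Cauchy–Schwarz
inequality.

*Network.* Each frequency `n < m` is a group of two channels, which carry the real and imaginary
parts of `z_n e^{iθ_n t}` for `t < 2^l`. As `e^{iθ(t + 2^l)} = e^{iθ 2^l} e^{iθ t}`, one transposed
convolution with kernel size `2` and dilation `2^l` doubles the length: its first tap copies the
signal, and its second tap appends the signal rotated by the angle `θ_n 2^l`. After `k + 1`
doublings a convolution without groups adds the real channels up, and its kernel size `2^k`, with only
the first tap nonzero, cuts the length `2^(k+1)` down to `2^k + 1` (`exists_network`).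
-/

noncomputable section

/-! ### The network: evaluation of a trigonometric polynomial by doubling -/

/-- The shape of a convolution with a single group from `4` to `2` channels. Its kernel size
`m + 2` makes it map inputs of length `2m+1` to outputs of length `m`. -/
abbrev selectShape (m : ℕ) : LayerShape where
  groups := 1
  inPerGroup := 4
  outPerGroup := 2
  kernelSize := m + 2
  stride := 1
  dilation := 1
  groups_pos := by norm_num
  inPerGroup_pos := by norm_num
  outPerGroup_pos := by norm_num
  kernelSize_pos := by omega
  stride_pos := by norm_num
  dilation_pos := by norm_num

/-- The shape of the transposed convolution, with `m` groups of two channels, that turns signals of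
length `d` into signals of length `2d`. -/
abbrev doublingShape (m d : ℕ) (hm : 0 < m) (hd : 0 < d) : LayerShape where
  groups := m
  inPerGroup := 2
  outPerGroup := 2
  kernelSize := 2
  stride := 1
  dilation := d
  groups_pos := hm
  inPerGroup_pos := by norm_num
  outPerGroup_pos := by norm_num
  kernelSize_pos := by norm_num
  stride_pos := by norm_num
  dilation_pos := hd

/-- The shape of a convolution with a single group that maps `2m` channels to one and shortens the
signal by `q - 1`. -/
abbrev sumShape (m q : ℕ) (hm : 0 < m) (hq : 0 < q) : LayerShape where
  groups := 1
  inPerGroup := m * 2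
  outPerGroup := 1
  kernelSize := q
  stride := 1
  dilation := 1
  groups_pos := by norm_num
  inPerGroup_pos := by omega
  outPerGroup_pos := by norm_num
  kernelSize_pos := hq
  stride_pos := by norm_num
  dilation_pos := by norm_num

/-- The layer parameters with the given weights, no bias and no activation. -/
def linearParams {S : LayerShape} {n' : ℕ}
    (w : Fin S.outCh → Fin S.inPerGroup → Fin S.kernelSize → ℝ) : LayerParams S n' where
  weight := w
  bias := 0
  activation := id

theorem linearParams_isLinear {S : LayerShape} {n' : ℕ}
    (w : Fin S.outCh → Fin S.inPerGroup → Fin S.kernelSize → ℝ) :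
    (linearParams w : LayerParams S n').IsLinear := ⟨rfl, rfl⟩

theorem linearParams_activeWeights {S : LayerShape} {n' : ℕ}
    (w : Fin S.outCh → Fin S.inPerGroup → Fin S.kernelSize → ℝ) :
    (linearParams w : LayerParams S n').activeWeights =
      Set.ncard {x : Fin S.outCh × Fin S.inPerGroup × Fin S.kernelSize |
        w x.1 x.2.1 x.2.2 ≠ 0} := by
  simp [LayerParams.activeWeights, linearParams]

theorem linearParams_activeWeights_le {S : LayerShape} {n' : ℕ}
    (w : Fin S.outCh → Fin S.inPerGroup → Fin S.kernelSize → ℝ) :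
    (linearParams w : LayerParams S n').activeWeights ≤
      S.outCh * (S.inPerGroup * S.kernelSize) := by
  rw [linearParams_activeWeights]
  refine (Set.ncard_le_card _).trans ?_
  simp

/-- The real part (`r = 0`) and the imaginary part (`r = 1`) of `z e^{iθt}`. -/
def wave (z : ℂ) (θ : ℝ) (t : ℕ) (r : Fin 2) : ℝ :=
  ![(z * Complex.exp (Complex.I * (θ * t : ℝ))).re,
    (z * Complex.exp (Complex.I * (θ * t : ℝ))).im] r

/-- The entries of the matrix of the rotation of the plane by the angle `α`. -/
def rotationEntry (α : ℝ) (r a : Fin 2) : ℝ :=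
  !![Real.cos α, -Real.sin α; Real.sin α, Real.cos α] r a

theorem wave_add (z : ℂ) (θ : ℝ) (t d : ℕ) (r : Fin 2) :
    wave z θ (t + d) r = ∑ a, rotationEntry (θ * d) r a * wave z θ t a := by
  have h : Complex.exp (Complex.I * (θ * (t + d : ℕ) : ℝ)) =
      Complex.exp (Complex.I * (θ * t : ℝ)) * Complex.exp (Complex.I * (θ * d : ℝ)) := by
    rw [← Complex.exp_add]; congr 1; push_cast; ring
  have h2 : Complex.exp (Complex.I * (θ * d : ℝ)) =
      Complex.mk (Real.cos (θ * d)) (Real.sin (θ * d)) := by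
    rw [mul_comm, Complex.exp_mul_I]
    apply Complex.ext <;> simp [-Complex.ofReal_mul, ← Complex.ofReal_cos, ← Complex.ofReal_sin]
  unfold wave
  rw [h, h2]
  fin_cases r <;> simp [-Complex.ofReal_mul, rotationEntry, Fin.sum_univ_two] <;> ring

/-- The complex number whose parts are the `n`-th entries of the first two channels, which is the
`n`-th entry of the vector that was fed to the network through `complexEmbed`. -/
def coeffOf {m : ℕ} (X : Tensor 4 (2 * m + 1)) (n : Fin m) : ℂ :=
  ⟨X 0 ⟨n, by omega⟩, X 1 ⟨n, by omega⟩⟩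

/-- Two layers discard the last `m + 1` entries of the input and put the real and imaginary parts of
the `n`-th one into the two channels of the `n`-th group, as signals of length `1`. -/
theorem exists_select (m : ℕ) (hm : 0 < m) : ∃ N : CNN 4 (2 * m + 1) (m * 2) 1,
    N.IsLinear ∧ N.depth = 2 ∧ N.activeWeights ≤ 24 * m ∧ N.convLayers = [selectShape m] ∧
    ∀ X (n : Fin m) (r : Fin 2),
      N.eval X (finProdFinEquiv (n, r)) 0 = ![(coeffOf X n).re, (coeffOf X n).im] r := by
  have hn : (selectShape m).dilation * ((selectShape m).kernelSize - 1) < 2 * m + 1 := by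
    simp; omega
  have hlen : (selectShape m).convLength (2 * m + 1) = m := by
    simp [LayerShape.convLength]; omega
  let N₀ : CNN 4 (2 * m + 1) (selectShape m).inCh (2 * m + 1) := CNN.nil
  let w : Fin (selectShape m).outCh → Fin (selectShape m).inPerGroup →
      Fin (selectShape m).kernelSize → ℝ :=
    fun k a i => if (a : ℕ) = k ∧ (i : ℕ) = 0 then 1 else 0
  let e : Fin (m * 2) × Fin 1 ≃
      Fin (selectShape m).outCh × Fin ((selectShape m).convLength (2 * m + 1)) :=
    (Equiv.prodUnique _ _).trans (finProdFinEquiv.symm.trans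
      ((Equiv.prodComm _ _).trans (Equiv.prodCongr (Equiv.refl _) (finCongr hlen.symm))))
  refine ⟨((N₀.conv _ hn (linearParams w)).reshape e), ?_, rfl, ?_, rfl, ?_⟩
  · exact ⟨trivial, linearParams_isLinear w⟩
  · have := linearParams_activeWeights_le (n' := (selectShape m).convLength (2 * m + 1)) w
    have h2 : (selectShape m).outCh * ((selectShape m).inPerGroup * (selectShape m).kernelSize)
      = 8 * (m + 2) := by simp [LayerShape.outCh]; ring
    simp only [CNN.activeWeights, N₀]
    omega
  · intro X n r
    have he : e (finProdFinEquiv (n, r), 0) = (r, Fin.cast hlen.symm n) := by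
      simp [e]
      rfl
    simp only [CNN.eval, he, LayerParams.conv, linearParams, N₀]
    have hin : ∀ a : Fin 4, (selectShape m).inputOf r a = a := by
      intro a
      ext
      fin_cases r <;> simp [LayerShape.inputOf, finProdFinEquiv, Fin.divNat]
    have h0 : ∀ a : Fin 4, ∑ i : Fin (m + 2), w r a i * X ((selectShape m).inputOf r a)
        ⟨(n : ℕ) * 1 + (i : ℕ) * 1, (selectShape m).window_lt hn (Fin.cast hlen.symm n) i⟩ =
        if (a : ℕ) = r then X a ⟨n, by omega⟩ else 0 := by
      intro a
      rw [Fintype.sum_eq_single (0 : Fin (m + 2))]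
      · simp [w, hin]
      · intro i hi
        have : (i : ℕ) ≠ 0 := fun h => hi (Fin.ext h)
        simp only [w, this, and_false, if_false, zero_mul]
    have h1 := Finset.sum_congr (s₁ := Finset.univ) rfl fun a _ => h0 a
    refine (add_zero _).trans (h1.trans ?_)
    fin_cases r <;> simp [Fin.sum_univ_four, coeffOf]

theorem divNat_finProdFinEquiv {m n : ℕ} (i : Fin m) (j : Fin n) :
    (finProdFinEquiv (i, j)).divNat = i :=
  congrArg Prod.fst (finProdFinEquiv.symm_apply_apply (i, j))

/-- The sum that defines a doubling layer, with identity first tap and second tap `R`: for `j < q`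
only the first tap contributes to the entry `j`, and for `q ≤ j` only the second one. -/
theorem sum_doubling {q j : ℕ} (hj : j < q + q) (r : Fin 2) (R : Fin 2 → Fin 2 → ℝ)
    (W : ℕ → Fin 2 → ℝ)
    (hW : q ≤ j → W (j - q + q) r = ∑ a, R r a * W (j - q) a) :
    ∑ a : Fin 2, ∑ i : Fin 2, ∑ t : Fin q, (if (t : ℕ) + (i : ℕ) * q = j then
      (if (i : ℕ) = 0 then (if (a : ℕ) = r then 1 else 0) else R r a) * W t a else 0) = W j r := by
  rcases lt_or_ge j q with h | h
  · have h1 : ∀ t : Fin q, ¬ ((t : ℕ) + q = j) := fun _ => by omega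
    have h2 : ∀ t : Fin q, ((t : ℕ) = j) ↔ t = ⟨j, h⟩ := fun t => by simp [Fin.ext_iff]
    fin_cases r <;> simp [Fin.sum_univ_two, h1, h2]
  · have h1 : ∀ t : Fin q, ¬ ((t : ℕ) = j) := fun t => by omega
    have h2 : ∀ t : Fin q, ((t : ℕ) + q = j) ↔ t = ⟨j - q, by omega⟩ := fun t => by
      simp only [Fin.ext_iff]; omega
    have := hW h
    rw [Nat.sub_add_cancel h] at this
    simp [h1, h2, this]

theorem exists_doubling (m : ℕ) (hm : 0 < m) (θ : Fin m → ℝ) (l : ℕ) :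
    ∃ N : CNN 4 (2 * m + 1) (m * 2) (2 ^ l),
    N.IsLinear ∧ N.depth = l + 2 ∧ N.activeWeights ≤ 24 * m + l * (8 * m) ∧
    (∃ L : List LayerShape, N.convLayers = L ++ [selectShape m] ∧
      ∀ S ∈ L, S.groups = m ∧ S.inCh ≤ 8 * m ∧ S.outCh ≤ 8 * m) ∧
    ∀ X (n : Fin m) (r : Fin 2) (j : Fin (2 ^ l)),
      N.eval X (finProdFinEquiv (n, r)) j = wave (coeffOf X n) (θ n) j r := by
  induction l with
  | zero =>
    obtain ⟨N, h1, h2, h3, h4, h5⟩ := exists_select m hm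
    refine ⟨N, h1, h2, by simpa using h3, ⟨[], by simpa using h4, by simp⟩, fun X n r j => ?_⟩
    have hj : j = (0 : Fin 1) := Subsingleton.elim (α := Fin 1) _ _
    subst hj
    refine (h5 X n r).trans ?_
    simp [wave]
  | succ l ih =>
    obtain ⟨N, h1, h2, h3, ⟨L, h4, h4'⟩, h5⟩ := ih
    have hd : 0 < 2 ^ l := by positivity
    have hlen : (doublingShape m (2 ^ l) hm hd).convTransposeLength (2 ^ l) = 2 ^ (l + 1) := by
      simp [LayerShape.convTransposeLength, pow_succ]; omega
    let w : Fin (doublingShape m (2 ^ l) hm hd).outCh →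
        Fin (doublingShape m (2 ^ l) hm hd).inPerGroup →
        Fin (doublingShape m (2 ^ l) hm hd).kernelSize → ℝ := fun k a i =>
      let p : Fin m × Fin 2 := finProdFinEquiv.symm k
      if (i : ℕ) = 0 then (if (a : ℕ) = p.2 then 1 else 0) else
        rotationEntry (θ p.1 * ((2 ^ l : ℕ) : ℝ)) p.2 a
    let N' := CNN.convTranspose (doublingShape m (2 ^ l) hm hd) N hd (linearParams w)
    have key : ∀ X (n : Fin m) (r : Fin 2)
        (j : Fin ((doublingShape m (2 ^ l) hm hd).convTransposeLength (2 ^ l))),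
        N'.eval X (finProdFinEquiv (n, r)) j = wave (coeffOf X n) (θ n) j r := by
      intro X n r j
      have hj : (j : ℕ) < 2 ^ l + 2 ^ l := by have := j.isLt; omega
      have hin : ∀ a : Fin 2, (doublingShape m (2 ^ l) hm hd).inputOf (finProdFinEquiv (n, r)) a =
          finProdFinEquiv (n, a) := fun a => by
        simp only [LayerShape.inputOf, divNat_finProdFinEquiv]
        rfl
      have hwt : ∀ a i : Fin 2, w (finProdFinEquiv (n, r)) a i = if (i : ℕ) = 0 then
          (if (a : ℕ) = r then 1 else 0) else rotationEntry (θ n * ((2 ^ l : ℕ) : ℝ)) r a := by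
        intro a i
        simp only [w, Equiv.symm_apply_apply]
      have h0 : ∀ a i : Fin 2, ∀ t : Fin (2 ^ l),
          w (finProdFinEquiv (n, r)) a i * N.eval X
            ((doublingShape m (2 ^ l) hm hd).inputOf (finProdFinEquiv (n, r)) a) t =
          (if (i : ℕ) = 0 then (if (a : ℕ) = r then 1 else 0) else
            rotationEntry (θ n * ((2 ^ l : ℕ) : ℝ)) r a) * wave (coeffOf X n) (θ n) t a := by
        intro a i t
        rw [hwt, hin, h5]
      refine (add_zero _).trans ?_
      refine Eq.trans ?_ (sum_doubling hj r _ _ fun _ =>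
        wave_add (coeffOf X n) (θ n) (j - 2 ^ l) (2 ^ l) r)
      exact Finset.sum_congr rfl fun a _ => Finset.sum_congr rfl fun i _ =>
        Finset.sum_congr rfl fun t _ => if_congr (by simp) (h0 a i t) rfl
    have hw := linearParams_activeWeights_le
      (n' := (doublingShape m (2 ^ l) hm hd).convTransposeLength (2 ^ l)) w
    have hw2 : (doublingShape m (2 ^ l) hm hd).outCh * ((doublingShape m (2 ^ l) hm hd).inPerGroup *
        (doublingShape m (2 ^ l) hm hd).kernelSize) = 8 * m := by
      simp [LayerShape.outCh]; ring
    rw [← hlen]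
    refine ⟨N', ⟨h1, linearParams_isLinear w⟩, ?_, ?_,
      ⟨doublingShape m (2 ^ l) hm hd :: L, ?_, ?_⟩, key⟩
    · change N.depth + 1 = _
      omega
    · change N.activeWeights + (linearParams w).activeWeights ≤ _
      rw [hw2] at hw
      linarith
    · change _ :: N.convLayers = _
      rw [h4]; rfl
    · intro S hS
      rcases List.mem_cons.mp hS with rfl | hS
      · simp [LayerShape.inCh, LayerShape.outCh]; omega
      · exact h4' S hS

theorem exists_network (m k : ℕ) (hm : 0 < m) (θ : Fin m → ℝ) :
    ∃ Ψ : CNN 4 (2 * m + 1) 1 (2 ^ k + 1),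
    Ψ.IsLinear ∧ Ψ.depth = k + 4 ∧ Ψ.activeWeights ≤ 34 * m + k * (8 * m) ∧
    (∃ L : List LayerShape, ∃ S₀ S₁ : LayerShape, Ψ.convLayers = S₀ :: (L ++ [S₁]) ∧
      (∀ S ∈ L, S.groups = m ∧ S.inCh ≤ 8 * m ∧ S.outCh ≤ 8 * m) ∧
      (∀ S ∈ [S₀, S₁], S.inCh ≤ 8 * m ∧ S.outCh ≤ 8 * m ∧ S.outCh ≤ 8)) ∧
    ∀ X (j : Fin (2 ^ k + 1)),
      Ψ.eval X 0 j = ∑ n : Fin m, wave (coeffOf X n) (θ n) j 0 := by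
  obtain ⟨N, h1, h2, h3, ⟨L, h4, h4'⟩, h5⟩ := exists_doubling m hm θ (k + 1)
  have hd : 0 < 2 ^ k := by positivity
  have hn : (sumShape m (2 ^ k) hm hd).dilation * ((sumShape m (2 ^ k) hm hd).kernelSize - 1)
      < 2 ^ (k + 1) := by
    simp [pow_succ]; omega
  have hlen : (sumShape m (2 ^ k) hm hd).convLength (2 ^ (k + 1)) = 2 ^ k + 1 := by
    simp [LayerShape.convLength, pow_succ]; omega
  let w : Fin (sumShape m (2 ^ k) hm hd).outCh → Fin (sumShape m (2 ^ k) hm hd).inPerGroup →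
      Fin (sumShape m (2 ^ k) hm hd).kernelSize → ℝ := fun _ a i =>
    let p : Fin m × Fin 2 := finProdFinEquiv.symm a
    if (i : ℕ) = 0 ∧ p.2 = 0 then 1 else 0
  have hin : (sumShape m (2 ^ k) hm hd).inCh = m * 2 := by simp [LayerShape.inCh]
  have : ∃ N₁ : CNN 4 (2 * m + 1) (sumShape m (2 ^ k) hm hd).inCh (2 ^ (k + 1)),
      N₁.IsLinear ∧ N₁.depth = k + 1 + 2 ∧ N₁.activeWeights ≤ 24 * m + (k + 1) * (8 * m) ∧
      N₁.convLayers = L ++ [selectShape m] ∧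
      ∀ X (n : Fin m) (r : Fin 2) (j : Fin (2 ^ (k + 1))),
      N₁.eval X (Fin.cast hin.symm (finProdFinEquiv (n, r))) j = wave (coeffOf X n) (θ n) j r := by
    clear_value w
    revert hin
    generalize (sumShape m (2 ^ k) hm hd).inCh = c
    rintro rfl
    exact ⟨N, h1, h2, h3, h4, h5⟩
  obtain ⟨N₁, h1, h2, h3, h4, h5⟩ := this
  let N' := CNN.conv (sumShape m (2 ^ k) hm hd) N₁ hn (linearParams w)
  have key : ∀ X (j : Fin ((sumShape m (2 ^ k) hm hd).convLength (2 ^ (k + 1)))),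
      N'.eval X (0 : Fin 1) j = ∑ n : Fin m, wave (coeffOf X n) (θ n) j 0 := by
    intro X j
    have hinp : ∀ a : Fin (m * 2), (sumShape m (2 ^ k) hm hd).inputOf (0 : Fin 1) a =
        Fin.cast hin.symm a := by
      intro a
      ext
      simp [LayerShape.inputOf, finProdFinEquiv, Fin.divNat]
    have h0 : ∀ a : Fin (m * 2), ∑ i : Fin (2 ^ k), w (0 : Fin 1) a i *
        N₁.eval X ((sumShape m (2 ^ k) hm hd).inputOf (0 : Fin 1) a)
          ⟨(j : ℕ) * 1 + (i : ℕ) * 1, (sumShape m (2 ^ k) hm hd).window_lt hn j i⟩ =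
        if (finProdFinEquiv.symm a).2 = 0 then
          wave (coeffOf X (finProdFinEquiv.symm a).1) (θ (finProdFinEquiv.symm a).1) j 0
        else 0 := by
      intro a
      rw [Fintype.sum_eq_single (⟨0, hd⟩ : Fin (2 ^ k))]
      · obtain ⟨⟨n, r⟩, rfl⟩ := finProdFinEquiv.surjective a
        rw [hinp, h5]
        simp only [w, Equiv.symm_apply_apply]
        by_cases hr : r = 0 <;> simp [hr]
      · intro i hi
        have : (i : ℕ) ≠ 0 := fun h => hi (Fin.ext h)
        simp only [w, this, false_and, if_false, zero_mul]
    have h1 := Finset.sum_congr (s₁ := Finset.univ) rfl fun a _ => h0 a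
    refine (add_zero _).trans (h1.trans ?_)
    rw [← finProdFinEquiv.sum_comp, Fintype.sum_prod_type]
    simp
  -- The kernel has `2^k` taps, so the number of weights has to be counted on the first tap only.
  have hw : (linearParams w :
      LayerParams _ ((sumShape m (2 ^ k) hm hd).convLength (2 ^ (k + 1)))).activeWeights ≤
      m * 2 := by
    rw [linearParams_activeWeights]
    refine (Set.ncard_le_ncard_of_injOn (t := (Set.univ : Set (Fin (m * 2)))) (fun x => x.2.1)
      (fun _ _ => Set.mem_univ _) ?_).trans (by simp [Set.ncard_univ])
    rintro ⟨x0, xa, xi⟩ hx ⟨y0, ya, yi⟩ hy hxy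
    have hx' : (xi : ℕ) = 0 := by
      by_contra h
      exact hx (by simp only [w, h, false_and, if_false])
    have hy' : (yi : ℕ) = 0 := by
      by_contra h
      exact hy (by simp only [w, h, false_and, if_false])
    have h1 : x0 = y0 := Subsingleton.elim (α := Fin 1) _ _
    have h2 : xi = yi := Fin.ext (hx'.trans hy'.symm)
    have h3 : xa = ya := hxy
    rw [h1, h2, h3]
  rw [← hlen]
  refine ⟨N', ⟨h1, linearParams_isLinear w⟩, ?_, ?_,
    ⟨L, sumShape m (2 ^ k) hm hd, selectShape m, ?_, h4', ?_⟩, key⟩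
  · simp [N', CNN.depth, h2]
  · simp only [N', CNN.activeWeights]
    linarith
  · simp [N', CNN.convLayers, h4]
  · simp [sumShape, selectShape, LayerShape.inCh, LayerShape.outCh]; omega

/-! ### Decay of Fourier coefficients -/

/-- Integration by parts for a function that agrees almost everywhere with a primitive of `G`,
against a `C¹` function that vanishes at the endpoints. -/
theorem integral_deriv_mul_primitive {a b κ : ℝ} (hab : a ≤ b) (h0 : (0 : ℝ) ∈ Icc a b)
    {φ φ' : ℝ → ℝ} (hφ : ∀ x, HasDerivAt φ (φ' x) x) (hc : Continuous φ')
    (ha : φ a = 0) (hb : φ b = 0) {F G : ℝ → ℝ} (hG : IntervalIntegrable G volume a b)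
    (hF : F =ᵐ[volume.restrict (Ioc a b)] fun x => κ + ∫ t in (0 : ℝ)..x, G t) :
    ∫ x in a..b, φ' x * F x = -∫ x in a..b, φ x * G x := by
  have hu : (0 : ℝ) ∈ uIcc a b := by rwa [uIcc_of_le hab]
  have hφ' : deriv φ = φ' := funext fun x => (hφ x).deriv
  have hφ1 : ContDiff ℝ 1 φ :=
    contDiff_one_iff_deriv.2 ⟨fun x => (hφ x).differentiableAt, hφ' ▸ hc⟩
  have hac := hG.absolutelyContinuousOnInterval_intervalIntegral hu
  have hφac : AbsolutelyContinuousOnInterval φ a b :=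
    hφ1.contDiffOn.absolutelyContinuousOnInterval
  have hparts := hac.integral_mul_deriv_eq_deriv_mul hφac
  rw [ha, hb, hφ'] at hparts
  have hconst : ∫ x in a..b, φ' x = 0 := by
    rw [intervalIntegral.integral_eq_sub_of_hasDerivAt (fun x _ => hφ x)
      (hc.intervalIntegrable _ _), ha, hb, sub_zero]
  have e1 : ∫ x in a..b, φ' x * F x =
      ∫ x in a..b, (κ * φ' x + (∫ t in (0 : ℝ)..x, G t) * φ' x) := by
    refine intervalIntegral.integral_congr_ae_restrict ?_
    rw [uIoc_of_le hab]
    filter_upwards [hF] with x hx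
    rw [hx]
    ring
  have e2 : ∫ x in a..b, deriv (fun x => ∫ t in (0 : ℝ)..x, G t) x * φ x =
      ∫ x in a..b, φ x * G x := by
    refine intervalIntegral.integral_congr_ae ?_
    filter_upwards [hG.ae_hasDerivAt_integral] with x hx hxm
    rw [(hx (uIoc_subset_uIcc hxm) 0 hu).deriv, mul_comm]
  rw [e1, intervalIntegral.integral_add ((hc.intervalIntegrable _ _).const_mul κ)
    (((hc.intervalIntegrable _ _).continuousOn_mul hac.continuousOn)),
    intervalIntegral.integral_const_mul, hconst, hparts, e2]
  ring

theorem intervalIntegrable_ofReal {a b : ℝ} {F : ℝ → ℝ} (h : IntervalIntegrable F volume a b) :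
    IntervalIntegrable (fun x => (F x : ℂ)) volume a b := ⟨h.1.ofReal, h.2.ofReal⟩

theorem integral_deriv_mul_primitive_complex {a b κ : ℝ} (hab : a ≤ b) (h0 : (0 : ℝ) ∈ Icc a b)
    {φ φ' : ℝ → ℂ} (hφ : ∀ x, HasDerivAt φ (φ' x) x) (hc : Continuous φ')
    (ha : φ a = 0) (hb : φ b = 0) {F G : ℝ → ℝ} (hG : IntervalIntegrable G volume a b)
    (hFi : IntervalIntegrable F volume a b)
    (hF : F =ᵐ[volume.restrict (Ioc a b)] fun x => κ + ∫ t in (0 : ℝ)..x, G t) :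
    ∫ x in a..b, φ' x * F x = -∫ x in a..b, φ x * G x := by
  have hcφ : Continuous φ := continuous_iff_continuousAt.2 fun x => (hφ x).continuousAt
  have h1 : IntervalIntegrable (fun x => φ' x * (F x : ℂ)) volume a b :=
    (intervalIntegrable_ofReal hFi).continuousOn_mul hc.continuousOn
  have h2 : IntervalIntegrable (fun x => φ x * (G x : ℂ)) volume a b :=
    (intervalIntegrable_ofReal hG).continuousOn_mul hcφ.continuousOn
  have hre := integral_deriv_mul_primitive hab h0 (φ := fun x => (φ x).re)
    (φ' := fun x => (φ' x).re) (fun x => Complex.reCLM.hasFDerivAt.comp_hasDerivAt x (hφ x))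
      (by fun_prop)
      (by simp [ha]) (by simp [hb]) hG hF
  have him := integral_deriv_mul_primitive hab h0 (φ := fun x => (φ x).im)
    (φ' := fun x => (φ' x).im) (fun x => Complex.imCLM.hasFDerivAt.comp_hasDerivAt x (hφ x))
      (by fun_prop)
      (by simp [ha]) (by simp [hb]) hG hF
  apply Complex.ext
  · have e1 := Complex.reCLM.intervalIntegral_comp_comm h1
    have e2 := Complex.reCLM.intervalIntegral_comp_comm h2
    simp only [Complex.reCLM_apply, Complex.mul_re, Complex.ofReal_re, Complex.ofReal_im,
      mul_zero, sub_zero] at e1 e2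
    rw [Complex.neg_re, ← e1, ← e2, hre]
  · have e1 := Complex.imCLM.intervalIntegral_comp_comm h1
    have e2 := Complex.imCLM.intervalIntegral_comp_comm h2
    simp only [Complex.imCLM_apply, Complex.mul_im, Complex.ofReal_re, Complex.ofReal_im,
      mul_zero, zero_add] at e1 e2
    rw [Complex.neg_im, ← e1, ← e2, him]

/-- Lebesgue measure on the period `(-1/2, 3/2]`, which contains `[0,1]` in its interior. -/
abbrev volP : Measure ℝ := volume.restrict (Ioc (-1 / 2 : ℝ) (3 / 2))

/-- The `n`-th Fourier coefficient, of period `2`, of the product of `g` and the cutoff `χ`. -/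
def fourierCut (χ g : ℝ → ℝ) (n : ℤ) : ℂ :=
  (1 / 2 : ℂ) * ∫ x in (-1 / 2 : ℝ)..(3 / 2),
    Complex.exp (-(Complex.I * Real.pi * n * x)) * χ x * g x

theorem half_lt : (-1 / 2 : ℝ) < 3 / 2 := by norm_num

theorem intervalIntegrable_of_memLp {g : ℝ → ℝ} (hg : MemLp g 2 volP) :
    IntervalIntegrable g volume (-1 / 2) (3 / 2) :=
  (intervalIntegrable_iff_integrableOn_Ioc_of_le half_lt.le).2 (hg.integrable one_le_two)

theorem fourierCut_eq (χ g : ℝ → ℝ) (n : ℤ) :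
    fourierCut χ g n = fourierCoeffOn half_lt (fun x => ((χ x * g x : ℝ) : ℂ)) n := by
  rw [fourierCoeffOn_eq_integral, fourierCut, Complex.real_smul]
  congr 1
  · norm_num
  · refine intervalIntegral.integral_congr fun x _ => ?_
    simp only [fourier_coe_apply, smul_eq_mul]
    push_cast
    rw [mul_assoc]
    congr 2
    ring

theorem fourierCut_congr (χ : ℝ → ℝ) {g g' : ℝ → ℝ} (h : g =ᵐ[volP] g') (n : ℤ) :
    fourierCut χ g n = fourierCut χ g' n := by
  unfold fourierCut
  congr 1
  rw [intervalIntegral.integral_of_le half_lt.le, intervalIntegral.integral_of_le half_lt.le]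
  refine integral_congr_ae ?_
  filter_upwards [h] with x hx
  rw [hx]

theorem sum_sq_fourierCut_le {χ g : ℝ → ℝ} (hχ : Continuous χ) {M : ℝ}
    (hM : ∀ x ∈ Icc (-1 / 2 : ℝ) (3 / 2), |χ x| ≤ M) (hg : MemLp g 2 volP) (A : Finset ℤ) :
    ∑ n ∈ A, ‖fourierCut χ g n‖ ^ 2 ≤ M ^ 2 * ∫ x, g x ^ 2 ∂volP := by
  have hm : MemLp (fun x => ((χ x * g x : ℝ) : ℂ)) 2 volP := by
    refine MemLp.of_le_mul (c := M) hg ?_ ?_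
    · exact Complex.continuous_ofReal.comp_aestronglyMeasurable
        (hχ.aestronglyMeasurable.mul hg.aestronglyMeasurable)
    · filter_upwards [ae_restrict_mem measurableSet_Ioc] with x hx
      rw [Complex.norm_real, norm_mul]
      exact mul_le_mul_of_nonneg_right (hM x (Ioc_subset_Icc_self hx)) (norm_nonneg _)
  have h := hasSum_sq_fourierCoeffOn half_lt hm
  have h2 := sum_le_hasSum A (fun _ _ => by positivity) h
  simp only [fourierCut_eq]
  refine h2.trans ?_
  have hsq : Integrable (fun x => g x ^ 2) volP := hg.integrable_sq
  have h3 : ∫ x in (-1 / 2 : ℝ)..(3 / 2), ‖((χ x * g x : ℝ) : ℂ)‖ ^ 2 ≤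
      ∫ x, M ^ 2 * g x ^ 2 ∂volP := by
    rw [intervalIntegral.integral_of_le half_lt.le]
    refine integral_mono_of_nonneg (ae_of_all _ fun _ => by positivity) (hsq.const_mul _) ?_
    filter_upwards [ae_restrict_mem measurableSet_Ioc] with x hx
    have hx' := hM x (Ioc_subset_Icc_self hx)
    rw [Complex.norm_real, norm_mul, mul_pow, Real.norm_eq_abs, Real.norm_eq_abs, sq_abs (g x)]
    gcongr
  rw [integral_const_mul] at h3
  have h4 : 0 ≤ ∫ x in (-1 / 2 : ℝ)..(3 / 2), ‖((χ x * g x : ℝ) : ℂ)‖ ^ 2 :=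
    intervalIntegral.integral_nonneg half_lt.le fun _ _ => by positivity
  rw [smul_eq_mul]
  norm_num at h3 h4 ⊢
  linarith

theorem intervalIntegrable_fourierCut {χ g : ℝ → ℝ} (hχ : Continuous χ) (hg : MemLp g 2 volP)
    (n : ℤ) : IntervalIntegrable
      (fun x => Complex.exp (-(Complex.I * Real.pi * n * x)) * χ x * (g x : ℂ)) volume
      (-1 / 2) (3 / 2) :=
  (intervalIntegrable_ofReal (intervalIntegrable_of_memLp hg)).continuousOn_mul (by fun_prop)

/-- If `F` is a primitive of `G`, then `iπn c_n(χF) = c_n(χ'F) + c_n(χG)`. -/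
theorem fourierCut_parts {χ : ℝ → ℝ} (hχ : ContDiff ℝ ∞ χ)
    (hs : tsupport χ ⊆ Ioo (-1 / 2 : ℝ) (3 / 2)) {F G : ℝ → ℝ} {κ : ℝ} (hFm : MemLp F 2 volP)
    (hGm : MemLp G 2 volP) (hF : F =ᵐ[volP] fun x => κ + ∫ t in (0 : ℝ)..x, G t) (n : ℤ) :
    (Complex.I * Real.pi * n) * fourierCut χ F n =
      fourierCut (deriv χ) F n + fourierCut χ G n := by
  have hGi := intervalIntegrable_of_memLp hGm
  have hFi := intervalIntegrable_of_memLp hFm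
  have hχ' : Continuous (deriv χ) := hχ.continuous_deriv (by simp)
  have hχc := hχ.continuous
  have hz : ∀ x, x ∉ Ioo (-1 / 2 : ℝ) (3 / 2) → χ x = 0 := fun x hx =>
    image_eq_zero_of_notMem_tsupport fun h => hx (hs h)
  let e : ℝ → ℂ := fun x => Complex.exp (-(Complex.I * Real.pi * n * x))
  have hec : Continuous e := by fun_prop
  have he : ∀ x : ℝ, HasDerivAt e (-(Complex.I * Real.pi * n) * e x) x := by
    intro x
    have h1 : HasDerivAt (fun y : ℝ => -(Complex.I * Real.pi * n * (y : ℂ)))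
        (-(Complex.I * Real.pi * n)) x := by
      have h2 := ((hasDerivAt_id x).ofReal_comp.const_mul (Complex.I * Real.pi * n)).neg
      rw [Complex.ofReal_one, mul_one] at h2
      exact h2
    simpa [e, mul_comm] using h1.cexp
  have hd : ∀ x : ℝ, HasDerivAt (fun y => e y * χ y)
      (-(Complex.I * Real.pi * n) * (e x * χ x) + e x * (deriv χ x : ℝ)) x := by
    intro x
    have h2 : HasDerivAt (fun y => (χ y : ℂ)) ((deriv χ x : ℝ) : ℂ) x :=
      ((hχ.differentiable (by simp)) x).hasDerivAt.ofReal_comp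
    exact ((he x).mul h2).congr_deriv (by ring)
  have key := integral_deriv_mul_primitive_complex half_lt.le (by constructor <;> norm_num) hd
    (by fun_prop) (by simp [hz]) (by simp [hz]) hGi hFi hF
  have i1 : IntervalIntegrable (fun x => e x * χ x * (F x : ℂ)) volume
      (-1 / 2) (3 / 2) :=
    intervalIntegrable_fourierCut ‹_› hFm n
  have i2 : IntervalIntegrable (fun x => e x * (deriv χ x : ℝ) * (F x : ℂ)) volume
      (-1 / 2) (3 / 2) :=
    intervalIntegrable_fourierCut ‹_› hFm n
  have h3 : ∫ x in (-1 / 2 : ℝ)..(3 / 2),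
      (-(Complex.I * Real.pi * n) * (e x * χ x) + e x * (deriv χ x : ℝ)) * (F x : ℂ) =
      -(Complex.I * Real.pi * n) * (∫ x in (-1 / 2 : ℝ)..(3 / 2), e x * χ x * (F x : ℂ)) +
      ∫ x in (-1 / 2 : ℝ)..(3 / 2), e x * (deriv χ x : ℝ) * (F x : ℂ) := by
    rw [← intervalIntegral.integral_const_mul, ← intervalIntegral.integral_add (i1.const_mul _) i2]
    refine intervalIntegral.integral_congr fun x _ => ?_
    ring
  rw [h3] at key
  simp only [fourierCut]
  linear_combination (-1 / 2 : ℂ) * key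

theorem integral_sq_eq_norm_sq (g : Lp ℝ 2 volP) : ∫ x, g x ^ 2 ∂volP = ‖g‖ ^ 2 := by
  rw [← real_inner_self_eq_norm_sq, L2.inner_def]
  exact integral_congr_ae (ae_of_all _ fun x => by simp [sq])

/-- If `F 0, …, F s` are such that each one is a primitive of the next one, then the Fourier
coefficients of `χ F 0` decay like those of a periodic `H^s` function. The statement quantifies over
all `χ` because the induction passes from `χ` to its derivative. -/
theorem exists_fourierCut_decay (s : ℕ) : ∀ χ : ℝ → ℝ, ContDiff ℝ ∞ χ →
    tsupport χ ⊆ Ioo (-1 / 2 : ℝ) (3 / 2) → ∃ C : ℝ, 0 ≤ C ∧ ∀ F : ℕ → Lp ℝ 2 volP,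
      (∀ j < s, ∃ κ : ℝ, F j =ᵐ[volP] fun x => κ + ∫ t in (0 : ℝ)..x, F (j + 1) t) →
      ∀ A : Finset ℤ, ∑ n ∈ A, (n : ℝ) ^ (2 * s) * ‖fourierCut χ (F 0) n‖ ^ 2 ≤
        C * ∑ j ∈ Finset.range (s + 1), ‖F j‖ ^ 2 := by
  induction s with
  | zero =>
    intro χ hχ hs
    obtain ⟨M, hM⟩ := isCompact_Icc.exists_bound_of_continuousOn (s := Icc (-1 / 2 : ℝ) (3 / 2))
      hχ.continuous.continuousOn
    refine ⟨M ^ 2, by positivity, fun F _ A => ?_⟩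
    have h := sum_sq_fourierCut_le hχ.continuous hM (Lp.memLp (F 0)) A
    rw [integral_sq_eq_norm_sq] at h
    simpa using h
  | succ s ih =>
    intro χ hχ hs
    obtain ⟨C₁, hC₁, h1⟩ := ih (deriv χ) (by
      exact (contDiff_infty_iff_deriv.1 hχ).2) ((tsupport_deriv_subset).trans hs)
    obtain ⟨C₂, hC₂, h2⟩ := ih χ hχ hs
    refine ⟨2 * C₁ + 2 * C₂, by positivity, fun F hF A => ?_⟩
    have h1 := h1 F (fun j hj => hF j (by omega)) A
    have h2 := h2 (fun j => F (j + 1)) (fun j hj => hF (j + 1) (by omega)) A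
    obtain ⟨κ, hκ⟩ := hF 0 (by omega)
    have e1 : ∑ j ∈ Finset.range (s + 1), ‖F j‖ ^ 2 ≤ ∑ j ∈ Finset.range (s + 1 + 1), ‖F j‖ ^ 2 :=
      by rw [Finset.sum_range_succ _ (s + 1)]; linarith [sq_nonneg ‖F (s + 1)‖]
    have e2 : ∑ j ∈ Finset.range (s + 1), ‖F (j + 1)‖ ^ 2 ≤
        ∑ j ∈ Finset.range (s + 1 + 1), ‖F j‖ ^ 2 := by
      rw [Finset.sum_range_succ' _ (s + 1)]; linarith [sq_nonneg ‖F 0‖]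
    have e3 : ∀ n ∈ A, (n : ℝ) ^ (2 * (s + 1)) * ‖fourierCut χ (F 0) n‖ ^ 2 ≤
        2 * ((n : ℝ) ^ (2 * s) * ‖fourierCut (deriv χ) (F 0) n‖ ^ 2) +
        2 * ((n : ℝ) ^ (2 * s) * ‖fourierCut χ (F 1) n‖ ^ 2) := by
      intro n _
      have hp := fourierCut_parts hχ hs (Lp.memLp _) (Lp.memLp _) hκ n
      have hnorm := congrArg norm hp
      simp only [norm_mul, Complex.norm_I, one_mul, Complex.norm_real, Complex.norm_intCast,
        zero_add] at hnorm
      have htri := norm_add_le (fourierCut (deriv χ) (F 0) n) (fourierCut χ (F 1) n)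
      have hpi : (1 : ℝ) ≤ ‖Real.pi‖ := by
        rw [Real.norm_of_nonneg Real.pi_pos.le]; linarith [Real.pi_gt_three]
      have h5 : |(n : ℝ)| * ‖fourierCut χ (F 0) n‖ ≤
          ‖fourierCut (deriv χ) (F 0) n‖ + ‖fourierCut χ (F 1) n‖ := by
        refine le_trans ?_ (hnorm.le.trans htri)
        have : 0 ≤ |(n : ℝ)| * ‖fourierCut χ (F 0) n‖ := by positivity
        nlinarith
      have h6 : (|(n : ℝ)| * ‖fourierCut χ (F 0) n‖) ^ 2 ≤
          2 * ‖fourierCut (deriv χ) (F 0) n‖ ^ 2 + 2 * ‖fourierCut χ (F 1) n‖ ^ 2 := by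
        refine (pow_le_pow_left₀ (by positivity) h5 2).trans ?_
        nlinarith [sq_nonneg (‖fourierCut (deriv χ) (F 0) n‖ - ‖fourierCut χ (F 1) n‖)]
      rw [mul_pow, sq_abs] at h6
      have h7 : 0 ≤ (n : ℝ) ^ (2 * s) := by rw [pow_mul]; positivity
      calc (n : ℝ) ^ (2 * (s + 1)) * ‖fourierCut χ (F 0) n‖ ^ 2
          = (n : ℝ) ^ (2 * s) * ((n : ℝ) ^ 2 * ‖fourierCut χ (F 0) n‖ ^ 2) := by ring
        _ ≤ (n : ℝ) ^ (2 * s) * (2 * ‖fourierCut (deriv χ) (F 0) n‖ ^ 2 +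
            2 * ‖fourierCut χ (F 1) n‖ ^ 2) := by gcongr
        _ = _ := by ring
    refine (Finset.sum_le_sum e3).trans ?_
    rw [Finset.sum_add_distrib, ← Finset.mul_sum, ← Finset.mul_sum]
    have e4 := mul_le_mul_of_nonneg_left e1 hC₁
    have e5 := mul_le_mul_of_nonneg_left e2 hC₂
    simp only [zero_add] at h2
    linarith

/-! ### The du Bois-Reymond lemma on `(0,1)` -/

theorem exists_Icc_of_isCompact {K : Set ℝ} (hK : IsCompact K) (h : K ⊆ Ioo (0 : ℝ) 1) :
    ∃ a b : ℝ, 0 < a ∧ b < 1 ∧ K ⊆ Icc a b := by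
  rcases K.eq_empty_or_nonempty with rfl | hne
  · exact ⟨1, 0, by norm_num, by norm_num, empty_subset _⟩
  · obtain ⟨a, ha⟩ := hK.exists_isLeast hne
    obtain ⟨b, hb⟩ := hK.exists_isGreatest hne
    exact ⟨a, b, (h ha.1).1, (h hb.1).2, fun x hx => ⟨ha.2 hx, hb.2 hx⟩⟩

/-- A test function on `(0,1)` of mean zero is the derivative of a test function on `(0,1)`. -/
theorem exists_testFunction_deriv_eq {ψ : ℝ → ℝ} (hψ : ContDiff ℝ ∞ ψ) (hc : HasCompactSupport ψ)
    (hs : tsupport ψ ⊆ Ioo (0 : ℝ) 1) (h0 : ∫ x in Ioo (0 : ℝ) 1, ψ x = 0) :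
    ∃ φ : ℝ → ℝ, ContDiff ℝ ∞ φ ∧ HasCompactSupport φ ∧ tsupport φ ⊆ Ioo (0 : ℝ) 1 ∧
      deriv φ = ψ := by
  obtain ⟨a, b, ha, hb, hab⟩ := exists_Icc_of_isCompact hc hs
  have hz : ∀ x, x ∉ Icc a b → ψ x = 0 := fun x hx =>
    image_eq_zero_of_notMem_tsupport fun h => hx (hab h)
  let φ : ℝ → ℝ := fun x => ∫ t in (0 : ℝ)..x, ψ t
  have hd : ∀ x, HasDerivAt φ (ψ x) x := fun x =>
    intervalIntegral.integral_hasDerivAt_right (hψ.continuous.intervalIntegrable _ _)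
      (hψ.continuous.stronglyMeasurableAtFilter _ _) hψ.continuous.continuousAt
  have hd' : deriv φ = ψ := funext fun x => (hd x).deriv
  have h01 : ∫ t in (0 : ℝ)..1, ψ t = 0 := by
    rw [intervalIntegral.integral_of_le zero_le_one, integral_Ioc_eq_integral_Ioo, h0]
  have hsub : tsupport φ ⊆ Icc a b := by
    refine closure_minimal (fun x hx => ?_) isClosed_Icc
    by_contra hxab
    apply hx
    rw [mem_Icc, not_and_or, not_le, not_le] at hxab
    rcases hxab with h | h
    · refine intervalIntegral.integral_zero_ae (ae_of_all _ fun t ht => hz t fun h' => ?_)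
      have := ht.2
      rcases le_total 0 x with h2 | h2
      · rw [max_eq_right h2] at this
        linarith [h'.1]
      · rw [max_eq_left h2] at this
        linarith [h'.1]
    · have h2 : φ x = (∫ t in (0 : ℝ)..1, ψ t) + ∫ t in (1 : ℝ)..x, ψ t :=
        (intervalIntegral.integral_add_adjacent_intervals
          (hψ.continuous.intervalIntegrable _ _) (hψ.continuous.intervalIntegrable _ _)).symm
      rw [h2, h01, zero_add]
      refine intervalIntegral.integral_zero_ae (ae_of_all _ fun t ht => hz t fun h' => ?_)
      have := ht.1
      rcases le_total 1 x with h2 | h2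
      · rw [min_eq_left h2] at this
        linarith [h'.2]
      · rw [min_eq_right h2] at this
        linarith [h'.2]
  refine ⟨φ, ?_, isCompact_Icc.of_isClosed_subset (isClosed_tsupport φ) hsub,
    hsub.trans fun x hx => ⟨ha.trans_le hx.1, hx.2.trans_lt hb⟩, hd'⟩
  rw [contDiff_infty_iff_deriv]
  exact ⟨fun x => (hd x).differentiableAt, hd' ▸ hψ⟩

/-- **du Bois-Reymond's lemma** on `(0,1)`. -/
theorem ae_eq_const_of_integral_mul_deriv_eq_zero {v : ℝ → ℝ} (hv : Integrable v volΩ)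
    (h : ∀ φ : ℝ → ℝ, ContDiff ℝ ∞ φ → HasCompactSupport φ → tsupport φ ⊆ Ioo (0 : ℝ) 1 →
      ∫ x in Ioo (0 : ℝ) 1, v x * deriv φ x = 0) :
    ∃ c : ℝ, v =ᵐ[volΩ] fun _ => c := by
  let B : ContDiffBump (1 / 2 : ℝ) := ⟨1 / 8, 1 / 4, by norm_num, by norm_num⟩
  let β : ℝ → ℝ := B.normed volume
  have hβ : ContDiff ℝ ∞ β := B.contDiff_normed
  have hβc : HasCompactSupport β := B.hasCompactSupport_normed
  have hβs : tsupport β ⊆ Ioo (0 : ℝ) 1 := by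
    rw [B.tsupport_normed_eq, Real.closedBall_eq_Icc]
    intro x hx
    have h1 := hx.1
    have h2 := hx.2
    simp only [B] at h1 h2
    constructor <;> linarith
  have hβ1 : ∫ x in Ioo (0 : ℝ) 1, β x = 1 := by
    rw [setIntegral_eq_integral_of_forall_compl_eq_zero, B.integral_normed]
    exact fun x hx => image_eq_zero_of_notMem_tsupport fun h => hx (hβs h)
  have hint : ∀ {ψ : ℝ → ℝ}, Continuous ψ → HasCompactSupport ψ →
      Integrable (fun x => ψ x * v x) volΩ := fun {ψ} h1 h2 => by
    obtain ⟨M, hM⟩ := h2.exists_bound_of_continuous h1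
    exact hv.bdd_mul h1.aestronglyMeasurable (ae_of_all _ hM)
  let c := ∫ x in Ioo (0 : ℝ) 1, β x * v x
  refine ⟨c, ?_⟩
  have hae := isOpen_Ioo.ae_eq_zero_of_integral_contDiff_smul_eq_zero (μ := volΩ)
    (U := Ioo (0 : ℝ) 1) (f := fun x => v x - c)
    ((hv.sub (integrable_const c)).locallyIntegrable.locallyIntegrableOn _) ?_
  · filter_upwards [hae, ae_restrict_mem measurableSet_Ioo] with x hx hm
    linarith [hx hm]
  · intro g hg hgc hgs
    -- Subtracting a multiple of the bump `β` from `g` leaves a test function of mean zero.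
    let A := ∫ x in Ioo (0 : ℝ) 1, g x
    have hgi : Integrable g volΩ := (hg.continuous.integrable_of_hasCompactSupport hgc).restrict
    have hβi : Integrable β volΩ := (hβ.continuous.integrable_of_hasCompactSupport hβc).restrict
    obtain ⟨φ, hφ, hφc, hφs, hφd⟩ := exists_testFunction_deriv_eq (ψ := fun x => g x - A * β x)
      (hg.sub (contDiff_const.mul hβ)) (hgc.sub (hβc.mul_left))
      (by
        refine closure_minimal (fun x hx => ?_) (isClosed_tsupport g |>.union (isClosed_tsupport β))
          |>.trans (union_subset hgs hβs)
        by_contra hcon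
        rw [mem_union, not_or] at hcon
        exact hx (by simp [image_eq_zero_of_notMem_tsupport hcon.1,
          image_eq_zero_of_notMem_tsupport hcon.2]))
      (by rw [integral_sub hgi (hβi.const_mul A), integral_const_mul, hβ1, mul_one, sub_self])
    have h1 := h φ hφ hφc hφs
    rw [hφd] at h1
    have i1 := hint hg.continuous hgc
    have i2 := hint hβ.continuous hβc
    have h2 : ∫ x in Ioo (0 : ℝ) 1, v x * (g x - A * β x) =
        (∫ x in Ioo (0 : ℝ) 1, g x * v x) - A * c := by
      rw [← integral_const_mul, ← integral_sub i1 (i2.const_mul A)]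
      exact integral_congr_ae (ae_of_all _ fun x => by ring)
    have h3 : ∫ x in Ioo (0 : ℝ) 1, g x • (v x - c) =
        (∫ x in Ioo (0 : ℝ) 1, g x * v x) - A * c := by
      rw [← integral_mul_const, ← integral_sub i1 (hgi.mul_const c)]
      exact integral_congr_ae (ae_of_all _ fun x => by simp only [smul_eq_mul]; ring)
    rw [h3, ← h2, h1]

/-! ### Extension of Sobolev functions -/

/-- The space `L²(-1/2, 3/2)`. -/
abbrev L2P : Type := Lp ℝ 2 volP

theorem volP_restrict : volP.restrict (Ioo (0 : ℝ) 1) = volΩ := by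
  rw [Measure.restrict_restrict measurableSet_Ioo, inter_eq_left.2]
  exact fun x hx => ⟨by linarith [hx.1], by linarith [hx.2]⟩

theorem volΩ_le_volP : volΩ ≤ volP := volP_restrict ▸ Measure.restrict_le_self

theorem ae_volΩ_of_volP {p : ℝ → Prop} (h : ∀ᵐ x ∂volP, p x) : ∀ᵐ x ∂volΩ, p x :=
  (Measure.absolutelyContinuous_of_le volΩ_le_volP).ae_le h

theorem memLp_indicator (f : Lp ℝ 2 volΩ) : MemLp ((Ioo (0 : ℝ) 1).indicator f) 2 volP := by
  rw [memLp_indicator_iff_restrict measurableSet_Ioo, volP_restrict]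
  exact Lp.memLp f

/-- Extension by zero, from `L²(0,1)` to `L²(-1/2, 3/2)`. -/
def extendZero : Lp ℝ 2 volΩ →L[ℝ] L2P :=
  LinearMap.mkContinuous
    { toFun := fun f => (memLp_indicator f).toLp
      map_add' := fun f g => by
        rw [← MemLp.toLp_add, MemLp.toLp_eq_toLp_iff]
        have h := Lp.coeFn_add f g
        filter_upwards [ae_restrict_of_ae ((ae_restrict_iff' measurableSet_Ioo).1 h)] with x hx
        by_cases hm : x ∈ Ioo (0 : ℝ) 1
        · simp only [Pi.add_apply, indicator_of_mem hm]
          exact hx hm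
        · simp [hm]
      map_smul' := fun a f => by
        rw [RingHom.id_apply, ← MemLp.toLp_const_smul, MemLp.toLp_eq_toLp_iff]
        have h := Lp.coeFn_smul a f
        filter_upwards [ae_restrict_of_ae ((ae_restrict_iff' measurableSet_Ioo).1 h)] with x hx
        by_cases hm : x ∈ Ioo (0 : ℝ) 1
        · simp [hm, hx hm]
        · simp [hm] } 1 fun f => by
    change ‖(memLp_indicator f).toLp‖ ≤ _
    rw [Lp.norm_toLp, eLpNorm_indicator_eq_eLpNorm_restrict measurableSet_Ioo, volP_restrict,
      one_mul, Lp.norm_def]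

theorem extendZero_ae (f : Lp ℝ 2 volΩ) : extendZero f =ᵐ[volΩ] f := by
  have h := ae_volΩ_of_volP (memLp_indicator f).coeFn_toLp
  filter_upwards [h, ae_restrict_mem measurableSet_Ioo] with x hx hm
  exact hx.trans (indicator_of_mem hm _)

theorem continuousOn_primitive (g : L2P) :
    ContinuousOn (fun x => ∫ t in (0 : ℝ)..x, g t) (Icc (-1 / 2) (3 / 2)) := by
  have h := intervalIntegral.continuousOn_primitive_interval'
    (intervalIntegrable_of_memLp (Lp.memLp g)) (a := 0) (by
      rw [uIcc_of_le half_lt.le]; constructor <;> norm_num)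
  rwa [uIcc_of_le half_lt.le] at h

theorem intervalIntegrable_zero (g : L2P) {x : ℝ} (hx : x ∈ Icc (-1 / 2 : ℝ) (3 / 2)) :
    IntervalIntegrable g volume 0 x := by
  refine (intervalIntegrable_of_memLp (Lp.memLp g)).mono_set ?_
  rw [uIcc_of_le half_lt.le]
  exact ordConnected_Icc.uIcc_subset (by constructor <;> norm_num) hx

/-- The constant is the `L²` norm of the function `1`, by the Cauchy–Schwarz inequality. -/
theorem abs_primitive_le (g : L2P) {x : ℝ} (hx : x ∈ Icc (-1 / 2 : ℝ) (3 / 2)) :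
    |∫ t in (0 : ℝ)..x, g t| ≤ ‖indicatorConstLp 2 (μ := volP) MeasurableSet.univ
      (measure_ne_top _ _) (1 : ℝ)‖ * ‖g‖ := by
  have h1 : |∫ t in (0 : ℝ)..x, g t| ≤ ∫ t, |g t| ∂volP := by
    refine (intervalIntegral.norm_integral_le_integral_norm_uIoc (f := g)).trans ?_
    refine setIntegral_mono_set ((Lp.memLp g).integrable one_le_two).norm
      (ae_of_all _ fun _ => norm_nonneg _) (LE.le.eventuallyLE fun t ht => ?_)
    exact ⟨(le_min (by norm_num) hx.1).trans_lt ht.1, ht.2.trans (max_le (by norm_num) hx.2)⟩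
  have h2 : ∫ t, |g t| ∂volP = inner ℝ (indicatorConstLp 2 (μ := volP) MeasurableSet.univ
      (measure_ne_top _ _) (1 : ℝ)) (Lp.memLp g).norm.toLp := by
    rw [L2.inner_indicatorConstLp_one, Measure.restrict_univ]
    refine integral_congr_ae ?_
    filter_upwards [(Lp.memLp g).norm.coeFn_toLp] with x hx
    rw [hx, Real.norm_eq_abs]
  refine h1.trans (h2.le.trans ((real_inner_le_norm _ _).trans ?_))
  rw [Lp.norm_toLp, eLpNorm_norm, ← Lp.norm_def]

theorem memLp_primitive (g : L2P) : MemLp (fun x => ∫ t in (0 : ℝ)..x, g t) 2 volP := by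
  refine MemLp.of_bound (((continuousOn_primitive g).mono Ioc_subset_Icc_self).aestronglyMeasurable
    measurableSet_Ioc)
    (‖indicatorConstLp 2 (μ := volP) MeasurableSet.univ (measure_ne_top _ _) (1 : ℝ)‖ * ‖g‖) ?_
  filter_upwards [ae_restrict_mem measurableSet_Ioc] with x hx
  exact abs_primitive_le g (Ioc_subset_Icc_self hx)

theorem primitive_congr {g g' : ℝ → ℝ} (h : g =ᵐ[volP] g') {x : ℝ}
    (hx : x ∈ Icc (-1 / 2 : ℝ) (3 / 2)) :
    ∫ t in (0 : ℝ)..x, g t = ∫ t in (0 : ℝ)..x, g' t := by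
  refine intervalIntegral.integral_congr_ae ?_
  have h' := (ae_restrict_iff' measurableSet_Ioc).1 h
  filter_upwards [h'] with t ht htx
  refine ht ?_
  rcases htx with ⟨h1, h2⟩
  exact ⟨lt_of_le_of_lt (le_min (by norm_num) hx.1) h1, h2.trans (max_le (by norm_num) hx.2)⟩

/-- The Volterra operator `g ↦ ∫₀ˣ g` on `L²(-1/2, 3/2)`. -/
def volterra : L2P →L[ℝ] L2P :=
  LinearMap.mkContinuous
    { toFun := fun g => (memLp_primitive g).toLp
      map_add' := fun f g => by
        rw [← MemLp.toLp_add, MemLp.toLp_eq_toLp_iff]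
        filter_upwards [ae_restrict_mem measurableSet_Ioc] with x hx
        have hx := Ioc_subset_Icc_self hx
        rw [primitive_congr (Lp.coeFn_add f g) hx, Pi.add_apply,
          ← intervalIntegral.integral_add (intervalIntegrable_zero f hx)
            (intervalIntegrable_zero g hx)]
        rfl
      map_smul' := fun a f => by
        rw [RingHom.id_apply, ← MemLp.toLp_const_smul, MemLp.toLp_eq_toLp_iff]
        filter_upwards [ae_restrict_mem measurableSet_Ioc] with x hx
        have hx := Ioc_subset_Icc_self hx
        rw [primitive_congr (Lp.coeFn_smul a f) hx, Pi.smul_apply,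
          ← intervalIntegral.integral_smul]
        rfl }
    ((volP univ).toReal ^ ((2 : ENNReal).toReal)⁻¹ * ‖indicatorConstLp 2 (μ := volP)
      MeasurableSet.univ (measure_ne_top _ _) (1 : ℝ)‖) fun g => by
    change ‖(memLp_primitive g).toLp‖ ≤ _
    rw [mul_assoc]
    refine Lp.norm_le_of_ae_bound (by positivity) ?_
    filter_upwards [(memLp_primitive g).coeFn_toLp, ae_restrict_mem measurableSet_Ioc] with x hx hm
    rw [hx]
    exact abs_primitive_le g (Ioc_subset_Icc_self hm)

theorem volterra_ae (g : L2P) : volterra g =ᵐ[volP] fun x => ∫ t in (0 : ℝ)..x, g t :=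
  (memLp_primitive g).coeFn_toLp

/-- The mean value over `(0,1)`. -/
def mean : L2P →L[ℝ] ℝ :=
  innerSL ℝ (indicatorConstLp 2 (μ := volP) (s := Ioo (0 : ℝ) 1) measurableSet_Ioo
    (measure_ne_top _ _) (1 : ℝ))

theorem mean_apply (g : L2P) : mean g = ∫ x in Ioo (0 : ℝ) 1, g x := by
  rw [mean, innerSL_apply_apply, L2.inner_indicatorConstLp_one, volP_restrict]

/-- The constant function `1` in `L²(-1/2, 3/2)`. -/
def constOne : L2P := indicatorConstLp 2 MeasurableSet.univ (measure_ne_top _ _) (1 : ℝ)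

theorem constOne_ae : constOne =ᵐ[volP] fun _ => 1 := by
  simpa [constOne] using indicatorConstLp_coeFn (p := 2) (μ := volP) (s := univ)
    (hs := MeasurableSet.univ) (hμs := measure_ne_top _ _) (c := (1 : ℝ))

/-- The `j`-th weak derivative on `H^s(0,1)`, with the value `0` for `j > s`. -/
def HSobolev.derivCLM (s j : ℕ) : HSobolev s →L[ℝ] Lp ℝ 2 volΩ :=
  if h : j < s + 1 then
    (PiLp.proj 2 (𝕜 := ℝ) (fun _ : Fin (s + 1) => Lp ℝ 2 volΩ) ⟨j, h⟩).comp (HSobolev s).subtypeL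
  else 0

/-- `extension s r f` extends the derivative `f^(s-r)` of `f ∈ H^s(0,1)` to `(-1/2, 3/2)`; so
`extension s s f` extends `f` itself. The derivative of order `s` is extended by zero, and each
further one is a primitive of the previous extension, with the constant of integration that gives
it the same mean value over `(0,1)` as `f^(s-r)`. -/
def extension (s : ℕ) : ℕ → HSobolev s →L[ℝ] L2P
  | 0 => extendZero.comp (HSobolev.derivCLM s s)
  | r + 1 => volterra.comp (extension s r) +
      (mean.comp (extendZero.comp (HSobolev.derivCLM s (s - (r + 1))) -
        volterra.comp (extension s r))).smulRight constOne

theorem extension_succ_ae (s r : ℕ) (f : HSobolev s) :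
    ∃ κ : ℝ, κ = mean (extendZero (HSobolev.derivCLM s (s - (r + 1)) f) -
      volterra (extension s r f)) ∧
      extension s (r + 1) f =ᵐ[volP] fun x => κ + ∫ t in (0 : ℝ)..x, extension s r f t := by
  refine ⟨_, rfl, ?_⟩
  set κ := mean (extendZero (HSobolev.derivCLM s (s - (r + 1)) f) - volterra (extension s r f))
    with hκ
  have h1 : extension s (r + 1) f = volterra (extension s r f) + κ • constOne := rfl
  rw [h1]
  filter_upwards [Lp.coeFn_add (volterra (extension s r f)) (κ • constOne),
    volterra_ae (extension s r f), Lp.coeFn_smul κ constOne, constOne_ae] with x h1 h2 h3 h4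
  rw [h1, Pi.add_apply, h2, h3, Pi.smul_apply, h4, smul_eq_mul, mul_one, add_comm]

theorem isWeakDeriv_derivCLM {s j : ℕ} (hj : j < s) (f : HSobolev s) :
    IsWeakDeriv (HSobolev.derivCLM s j f) (HSobolev.derivCLM s (j + 1) f) := by
  have h := f.2 ⟨j, hj⟩
  simpa [HSobolev.derivCLM, hj, hj.trans (Nat.lt_succ_self s)] using h

/-- If `g` is the weak derivative of `u` on `(0,1)`, then `u` is the primitive, of the same mean
value, of any extension `G` of `g`. -/
theorem IsWeakDeriv.ae_eq_primitive {u g : Lp ℝ 2 volΩ} (h : IsWeakDeriv u g) {G : L2P}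
    (hG : G =ᵐ[volΩ] g) :
    u =ᵐ[volΩ] fun x => mean (extendZero u - volterra G) + ∫ t in (0 : ℝ)..x, G t := by
  let P : ℝ → ℝ := fun x => ∫ t in (0 : ℝ)..x, G t
  have hPm : MemLp P 2 volΩ := (memLp_primitive G).mono_measure volΩ_le_volP
  have hv : MemLp (fun x => u x - P x) 2 volΩ := (Lp.memLp u).sub hPm
  obtain ⟨c, hc⟩ := ae_eq_const_of_integral_mul_deriv_eq_zero (hv.integrable one_le_two) (by
    intro φ hφ hφc hφs
    have hd : Continuous (deriv φ) := hφ.continuous_deriv (by simp)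
    have h1 := h φ hφ hφc hφs
    have h2 := integral_deriv_mul_primitive (a := 0) (b := 1) (κ := 0) zero_le_one
      (by simp) (fun x => (hφ.differentiable (by simp) x).hasDerivAt) hd
      (image_eq_zero_of_notMem_tsupport fun h => lt_irrefl _ (hφs h).1)
      (image_eq_zero_of_notMem_tsupport fun h => lt_irrefl _ (hφs h).2)
      (intervalIntegrable_zero G (by constructor <;> norm_num)) (F := P)
      (ae_of_all _ fun x => by simp [P])
    rw [intervalIntegral.integral_of_le zero_le_one, intervalIntegral.integral_of_le zero_le_one,
      integral_Ioc_eq_integral_Ioo, integral_Ioc_eq_integral_Ioo] at h2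
    have h3 : ∫ x in Ioo (0 : ℝ) 1, φ x * G x = ∫ x in Ioo (0 : ℝ) 1, g x * φ x := by
      refine integral_congr_ae ?_
      filter_upwards [hG] with x hx
      rw [hx, mul_comm]
    have i2 : Integrable (fun x => deriv φ x * P x) volΩ := by
      obtain ⟨M, hM⟩ := hφc.deriv.exists_bound_of_continuous hd
      exact (hPm.integrable one_le_two).bdd_mul hd.aestronglyMeasurable (ae_of_all _ hM)
    have h4 : ∫ x in Ioo (0 : ℝ) 1, (u x - P x) * deriv φ x =
        (∫ x in Ioo (0 : ℝ) 1, u x * deriv φ x) - ∫ x in Ioo (0 : ℝ) 1, deriv φ x * P x := by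
      rw [← integral_sub (integrable_Lp_mul u hd hφc.deriv) i2]
      exact integral_congr_ae (ae_of_all _ fun x => by ring)
    rw [h4, h1, h2, h3, sub_self])
  have hmean : mean (extendZero u - volterra G) = c := by
    rw [mean_apply]
    have : ∫ x in Ioo (0 : ℝ) 1, (extendZero u - volterra G) x = ∫ x in Ioo (0 : ℝ) 1, c := by
      refine integral_congr_ae ?_
      filter_upwards [hc, extendZero_ae u, ae_volΩ_of_volP (volterra_ae G),
        ae_volΩ_of_volP (Lp.coeFn_sub (extendZero u) (volterra G))] with x h1 h2 h3 h4
      rw [h4, Pi.sub_apply, h2, h3]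
      exact h1
    rw [this]
    simp
  filter_upwards [hc] with x hx
  rw [hmean]
  simp only [P] at hx
  linarith

theorem extension_ae (s r : ℕ) (hr : r ≤ s) (f : HSobolev s) :
    extension s r f =ᵐ[volΩ] HSobolev.derivCLM s (s - r) f := by
  induction r with
  | zero => exact extendZero_ae _
  | succ r ih =>
    have ih := ih (by omega)
    obtain ⟨κ, hκ, h⟩ := extension_succ_ae s r f
    have hw := isWeakDeriv_derivCLM (show s - (r + 1) < s by omega) f
    rw [show s - (r + 1) + 1 = s - r by omega] at hw
    have hu := hw.ae_eq_primitive ih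
    rw [← hκ] at hu
    exact Filter.EventuallyEq.trans (ae_volΩ_of_volP h) hu.symm

/-! ### Fourier coefficients of the extended function -/

/-- A smooth cutoff function, equal to `1` on `[0,1]` and supported in `[-1/4, 5/4]`. -/
def cutoff : ContDiffBump (1 / 2 : ℝ) := ⟨1 / 2, 3 / 4, by norm_num, by norm_num⟩

theorem tsupport_cutoff : tsupport cutoff ⊆ Ioo (-1 / 2 : ℝ) (3 / 2) := by
  rw [cutoff.tsupport_eq, Real.closedBall_eq_Icc]
  intro x hx
  have h1 := hx.1
  have h2 := hx.2
  simp only [cutoff] at h1 h2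
  constructor <;> linarith

theorem cutoff_eq_one {x : ℝ} (hx : x ∈ Icc (0 : ℝ) 1) : cutoff x = 1 := by
  refine cutoff.one_of_mem_closedBall ?_
  rw [Real.closedBall_eq_Icc]
  simp only [cutoff]
  constructor <;> linarith [hx.1, hx.2]

theorem norm_fourierCut_cutoff_le (g : L2P) (n : ℤ) : ‖fourierCut cutoff g n‖ ≤ 1 * ‖g‖ := by
  have h := sum_sq_fourierCut_le cutoff.continuous (M := 1)
    (fun x _ => by rw [abs_of_nonneg cutoff.nonneg]; exact cutoff.le_one) (Lp.memLp g) {n}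
  rw [Finset.sum_singleton, integral_sq_eq_norm_sq, ← mul_pow] at h
  exact le_of_sq_le_sq h (by positivity)

/-- The Fourier coefficient of the product with `cutoff`, as a continuous real-linear functional. -/
def cutoffCoeff (n : ℤ) : L2P →L[ℝ] ℂ :=
  LinearMap.mkContinuous
    { toFun := fun g => fourierCut cutoff g n
      map_add' := fun f g => by
        rw [fourierCut_congr _ (Lp.coeFn_add f g)]
        simp only [fourierCut]
        rw [← mul_add, ← intervalIntegral.integral_add
          (intervalIntegrable_fourierCut cutoff.continuous (Lp.memLp f) n)
          (intervalIntegrable_fourierCut cutoff.continuous (Lp.memLp g) n)]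
        congr 1
        refine intervalIntegral.integral_congr fun x _ => ?_
        simp only [Pi.add_apply, Complex.ofReal_add]
        ring
      map_smul' := fun a f => by
        rw [fourierCut_congr _ (Lp.coeFn_smul a f), RingHom.id_apply]
        change fourierCut cutoff (a • ⇑f) n = ((a : ℝ) • fourierCut cutoff f n : ℂ)
        rw [Complex.real_smul, fourierCut, fourierCut]
        rw [mul_left_comm (a : ℂ), ← intervalIntegral.integral_const_mul (a : ℂ)]
        congr 1
        refine intervalIntegral.integral_congr fun x _ => ?_
        simp only [Pi.smul_apply, smul_eq_mul, Complex.ofReal_mul]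
        ring } 1 fun g => norm_fourierCut_cutoff_le g n

/-- The operator `T`: the Fourier coefficients `c₀, 2c₁, 2c₂, …, 2c_{2m}` of the extension of `f`
times `cutoff`. -/
def sobolevCoeff (s m : ℕ) : HSobolev s →L[ℝ] (Fin (2 * m + 1) → ℂ) :=
  ContinuousLinearMap.pi fun i =>
    (if (i : ℕ) = 0 then (1 : ℝ) else 2) • (cutoffCoeff (i : ℕ)).comp (extension s s)

theorem sobolevCoeff_apply (s m : ℕ) (f : HSobolev s) (i : Fin (2 * m + 1)) :
    sobolevCoeff s m f i =
      (if (i : ℕ) = 0 then 1 else 2) * fourierCut cutoff (extension s s f) (i : ℕ) := by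
  change (if (i : ℕ) = 0 then (1 : ℝ) else 2) • (fourierCut cutoff (extension s s f) (i : ℕ)) = _
  rw [Complex.real_smul]
  split_ifs <;> simp

theorem fourierCut_neg (χ g : ℝ → ℝ) (n : ℤ) :
    fourierCut χ g (-n) = (starRingEnd ℂ) (fourierCut χ g n) := by
  simp only [fourierCut, map_mul]
  rw [intervalIntegral.integral_of_le half_lt.le, intervalIntegral.integral_of_le half_lt.le,
    ← integral_conj]
  congr 1
  · simp [Complex.conj_ofNat]
  · refine integral_congr_ae (ae_of_all _ fun x => ?_)
    simp [← Complex.exp_conj]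

theorem exists_sobolev_decay (s : ℕ) : ∃ C : ℝ, 0 ≤ C ∧ ∀ f : HSobolev s, ∀ A : Finset ℤ,
    ∑ n ∈ A, (n : ℝ) ^ (2 * s) * ‖fourierCut cutoff (extension s s f) n‖ ^ 2 ≤ C * ‖f‖ ^ 2 := by
  obtain ⟨C, hC, h⟩ := exists_fourierCut_decay s cutoff cutoff.contDiff tsupport_cutoff
  refine ⟨C * ∑ j ∈ Finset.range (s + 1), ‖extension s (s - j)‖ ^ 2, by positivity, fun f A => ?_⟩
  have h1 := h (fun j => extension s (s - j) f) (fun j hj => by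
    obtain ⟨κ, -, hκ⟩ := extension_succ_ae s (s - (j + 1)) f
    rw [show s - (j + 1) + 1 = s - j by omega] at hκ
    exact ⟨κ, hκ⟩) A
  refine h1.trans ?_
  rw [mul_assoc, Finset.sum_mul]
  refine mul_le_mul_of_nonneg_left (Finset.sum_le_sum fun j _ => ?_) hC
  rw [← mul_pow]
  exact pow_le_pow_left₀ (norm_nonneg _) ((extension s (s - j)).le_opNorm f) 2

/-! ### Truncation of the Fourier series -/

theorem summable_of_decay {c : ℤ → ℂ} {s : ℕ} (hs : 1 ≤ s) {B : ℝ}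
    (hB : ∀ A : Finset ℤ, ∑ n ∈ A, (n : ℝ) ^ (2 * s) * ‖c n‖ ^ 2 ≤ B) : Summable c := by
  have h1 : Summable fun n : ℤ => (n : ℝ) ^ (2 * s) * ‖c n‖ ^ 2 :=
    summable_of_sum_le (fun n => mul_nonneg (by rw [pow_mul]; positivity) (by positivity)) hB
  have h2 : Summable fun n : ℤ => 1 / (n : ℝ) ^ 2 := Real.summable_one_div_int_pow.2 one_lt_two
  refine Summable.of_norm_bounded ((h1.add h2).add (hasSum_ite_eq (0 : ℤ) ‖c 0‖).summable)
    fun n => ?_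
  by_cases hn : n = 0
  · subst hn
    simp [show s ≠ 0 by omega]
  · rw [if_neg hn, add_zero]
    have hn1 : (1 : ℝ) ≤ (n : ℝ) ^ 2 := by
      have : (0 : ℤ) < n ^ 2 := by positivity
      exact_mod_cast this
    have hn2 : (n : ℝ) ^ 2 ≤ (n : ℝ) ^ (2 * s) := by
      rw [pow_mul]
      exact le_self_pow₀ hn1 (by omega)
    have h3 : (n : ℝ) ^ 2 * ‖c n‖ ^ 2 ≤ (n : ℝ) ^ (2 * s) * ‖c n‖ ^ 2 := by gcongr
    -- Completing the square, since `|c| = (n |c|) * n⁻¹`.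
    have h4 : ‖c n‖ ≤ (n : ℝ) ^ 2 * ‖c n‖ ^ 2 + 1 / (n : ℝ) ^ 2 := by
      have h5 : 0 < (n : ℝ) ^ 2 := by linarith
      rw [← sub_nonneg]
      have : (n : ℝ) ^ 2 * ‖c n‖ ^ 2 + 1 / (n : ℝ) ^ 2 - ‖c n‖ =
          (((n : ℝ) ^ 2 * ‖c n‖ - 1 / 2) ^ 2 + 3 / 4) / (n : ℝ) ^ 2 := by
        field_simp
        ring
      rw [this]
      positivity
    linarith

/-- By the Cauchy–Schwarz inequality and `∑_{n ≥ m} n^(-2s) ≤ 2 m^(1-2s)`. -/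
theorem sum_Ico_norm_le {c : ℤ → ℂ} {s m : ℕ} (hs : 1 ≤ s) (hm : 1 ≤ m) {B : ℝ} (hB0 : 0 ≤ B)
    (hB : ∀ A : Finset ℤ, ∑ n ∈ A, (n : ℝ) ^ (2 * s) * ‖c n‖ ^ 2 ≤ B ^ 2) (N : ℕ) :
    ∑ n ∈ Finset.Ico m N, ‖c n‖ ≤ 2 * ((m : ℝ) ^ ((1 : ℝ) / 2 - s) * B) := by
  obtain ⟨r, rfl⟩ : ∃ r, s = r + 1 := ⟨s - 1, by omega⟩
  have hm0 : (0 : ℝ) < m := by exact_mod_cast hm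
  have hcs := Finset.sum_mul_sq_le_sq_mul_sq (Finset.Ico m N) (fun n : ℕ => ((n : ℝ) ^ (r + 1))⁻¹)
    (fun n : ℕ => (n : ℝ) ^ (r + 1) * ‖c n‖)
  have e1 : ∑ n ∈ Finset.Ico m N, ((n : ℝ) ^ (r + 1))⁻¹ * ((n : ℝ) ^ (r + 1) * ‖c n‖) =
      ∑ n ∈ Finset.Ico m N, ‖c n‖ := by
    refine Finset.sum_congr rfl fun n hn => ?_
    have : (0 : ℝ) < n := by
      exact_mod_cast lt_of_lt_of_le hm (Finset.mem_Ico.1 hn).1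
    field_simp
  have e2 : ∑ n ∈ Finset.Ico m N, ((n : ℝ) ^ (r + 1) * ‖c n‖) ^ 2 ≤ B ^ 2 := by
    have := hB ((Finset.Ico m N).map Nat.castEmbedding)
    rw [Finset.sum_map] at this
    refine le_trans (le_of_eq (Finset.sum_congr rfl fun n _ => ?_)) this
    simp only [Nat.castEmbedding_apply, Int.cast_natCast]
    ring
  have hrp : ((m : ℝ) ^ ((1 : ℝ) / 2 - (r + 1 : ℕ))) ^ 2 = ((m : ℝ) ^ (2 * r + 1))⁻¹ := by
    rw [← Real.rpow_natCast, ← Real.rpow_mul hm0.le, ← Real.rpow_natCast, ← Real.rpow_neg hm0.le]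
    congr 1
    push_cast
    ring
  have e3 : ∑ n ∈ Finset.Ico m N, (((n : ℝ) ^ (r + 1))⁻¹) ^ 2 ≤
      2 * ((m : ℝ) ^ ((1 : ℝ) / 2 - (r + 1 : ℕ))) ^ 2 := by
    have h1 : ∀ n ∈ Finset.Ico m N, (((n : ℝ) ^ (r + 1))⁻¹) ^ 2 ≤
        ((m : ℝ) ^ (2 * r))⁻¹ * ((n : ℝ) ^ 2)⁻¹ := by
      intro n hn
      have hmn : (m : ℝ) ≤ n := by exact_mod_cast (Finset.mem_Ico.1 hn).1
      have hn0 : (0 : ℝ) < n := hm0.trans_le hmn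
      have : (((n : ℝ) ^ (r + 1))⁻¹) ^ 2 = ((n : ℝ) ^ (2 * r))⁻¹ * ((n : ℝ) ^ 2)⁻¹ := by
        rw [← mul_inv, ← pow_add, inv_pow, ← pow_mul]
        congr 2
        ring
      rw [this]
      gcongr
    refine (Finset.sum_le_sum h1).trans ?_
    rw [← Finset.mul_sum]
    have h2 := sum_Ioo_inv_sq_le (α := ℝ) (m - 1) N
    have h3 : Finset.Ioo (m - 1) N = Finset.Ico m N := by
      ext x; simp only [Finset.mem_Ioo, Finset.mem_Ico]; omega
    have h4 : ((m - 1 : ℕ) : ℝ) + 1 = m := by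
      have : m - 1 + 1 = m := by omega
      exact_mod_cast this
    rw [h3, h4] at h2
    refine (mul_le_mul_of_nonneg_left h2 (by positivity)).trans (le_of_eq ?_)
    rw [hrp, pow_succ]
    field_simp
  rw [e1] at hcs
  refine le_of_sq_le_sq ?_ (by positivity)
  refine hcs.trans ((mul_le_mul e3 e2 (Finset.sum_nonneg fun _ _ => by positivity)
    (by positivity)).trans ?_)
  have : 0 ≤ (((m : ℝ) ^ ((1 : ℝ) / 2 - (r + 1 : ℕ))) * B) ^ 2 := by positivity
  nlinarith

/-- The truncation error of the Fourier series of a real function, at a point `x` at which the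
series converges to the value `U` of the function. -/
theorem abs_sub_partialSum_le {c : ℤ → ℂ} {s m : ℕ} (hs : 1 ≤ s) (hm : 1 ≤ m) {B : ℝ}
    (hB0 : 0 ≤ B)
    (hB : ∀ A : Finset ℤ, ∑ n ∈ A, (n : ℝ) ^ (2 * s) * ‖c n‖ ^ 2 ≤ B ^ 2)
    (hc : ∀ n, c (-n) = (starRingEnd ℂ) (c n)) {x U : ℝ}
    (hU : HasSum (fun n : ℤ => c n * Complex.exp (Complex.I * (Real.pi * n * x : ℝ))) (U : ℂ)) :
    |U - ∑ n ∈ Finset.range m, ((if n = 0 then 1 else 2) * c n *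
      Complex.exp (Complex.I * (Real.pi * n * x : ℝ))).re| ≤
      4 * ((m : ℝ) ^ ((1 : ℝ) / 2 - s) * B) := by
  let e : ℤ → ℂ := fun n => Complex.exp (Complex.I * (Real.pi * n * x : ℝ))
  have he : ∀ n, e (-n) = (starRingEnd ℂ) (e n) := fun n => by
    simp only [e, ← Complex.exp_conj]
    congr 1
    simp
  let a : ℕ → ℝ := fun n => ((if n = 0 then 1 else 2) * c n * e n).re
  -- Folding the series onto `ℕ` counts the term `n = 0` twice.
  have h1 := (Complex.hasSum_re hU.nat_add_neg).sub (hasSum_ite_eq 0 (c 0 * e 0).re)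
  have ha : HasSum a U := by
    have h3 : ((U : ℂ) + c 0 * e 0).re - (c 0 * e 0).re = U := by
      rw [Complex.add_re, Complex.ofReal_re, add_sub_cancel_right]
    refine (h3 ▸ h1).congr_fun fun n => ?_
    have h2 : c (-n) * e (-n) = (starRingEnd ℂ) (c n * e n) := by rw [hc, he, map_mul]
    change a n = (c n * e n + c (-n) * e (-n)).re - _
    rw [h2, Complex.add_re, Complex.conj_re]
    by_cases hn : n = 0
    · subst hn
      simp [a]
    · simp only [a, if_neg hn, sub_zero]
      rw [mul_assoc, show (2 : ℂ) = ((2 : ℝ) : ℂ) by norm_num, Complex.re_ofReal_mul]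
      ring
  have hen : ∀ n : ℕ, |a n| ≤ 2 * ‖c n‖ := fun n => by
    refine (Complex.abs_re_le_norm _).trans ?_
    have : ‖e n‖ = 1 := by
      simp only [e]
      rw [mul_comm]
      exact Complex.norm_exp_ofReal_mul_I _
    rw [norm_mul, norm_mul, this, mul_one]
    refine mul_le_mul_of_nonneg_right ?_ (norm_nonneg _)
    split_ifs <;> simp
  have hlim := ((ha.tendsto_sum_nat).sub_const (∑ n ∈ Finset.range m, a n)).abs
  refine le_of_tendsto hlim ?_
  filter_upwards [Filter.eventually_ge_atTop m] with N hN
  rw [← Finset.sum_Ico_eq_sub _ hN]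
  calc |∑ n ∈ Finset.Ico m N, a n| ≤ ∑ n ∈ Finset.Ico m N, |a n| := Finset.abs_sum_le_sum_abs _ _
    _ ≤ ∑ n ∈ Finset.Ico m N, 2 * ‖c n‖ := Finset.sum_le_sum fun n _ => hen n
    _ = 2 * ∑ n ∈ Finset.Ico m N, ‖c n‖ := by rw [Finset.mul_sum]
    _ ≤ _ := by linarith [sum_Ico_norm_le hs hm hB0 hB N]

/-- On `[0,1]`, where the cutoff is `1`, the Fourier series recovers `u`. -/
theorem hasSum_fourierCut {u : ℝ → ℝ} (hu : ContinuousOn u (Icc (-1 / 2) (3 / 2)))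
    (hsum : Summable (fourierCut cutoff u)) {x : ℝ} (hx : x ∈ Icc (0 : ℝ) 1) :
    HasSum (fun n : ℤ => fourierCut cutoff u n * Complex.exp (Complex.I * (Real.pi * n * x : ℝ)))
      (u x : ℂ) := by
  have : Fact ((0 : ℝ) < 2) := ⟨two_pos⟩
  let G : ℝ → ℂ := fun x => ((cutoff x * u x : ℝ) : ℂ)
  have hab : (-1 / 2 : ℝ) + 2 = 3 / 2 := by norm_num
  have hz : ∀ x, x ∉ Ioo (-1 / 2 : ℝ) (3 / 2) → G x = 0 := fun x hx => by
    simp [G, image_eq_zero_of_notMem_tsupport fun h => hx (tsupport_cutoff h)]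
  have hGc : ContinuousOn G (Icc (-1 / 2) (-1 / 2 + 2)) := by
    rw [hab]
    exact Complex.continuous_ofReal.comp_continuousOn (cutoff.continuous.continuousOn.mul hu)
  let F : C(AddCircle (2 : ℝ), ℂ) := ⟨AddCircle.liftIco 2 (-1 / 2) G,
    AddCircle.liftIco_continuous (by rw [hz _ (by simp), hz _ (by simp [hab])]) hGc⟩
  have hco : fourierCoeff F = fourierCut cutoff u := by
    funext n
    refine (fourierCoeff_liftIco_eq (T := 2) (a := -1 / 2) G n).trans ?_
    rw [fourierCut_eq]
    have : ∀ (b : ℝ) (h : -1 / 2 < b), b = 3 / 2 →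
        fourierCoeffOn h G n = fourierCoeffOn half_lt G n := by
      rintro b h rfl
      rfl
    exact this _ _ hab
  have h := has_pointwise_sum_fourier_series_of_summable (f := F) (hco ▸ hsum)
    (x : AddCircle (2 : ℝ))
  have hFx : F (x : AddCircle (2 : ℝ)) = u x := by
    refine (AddCircle.liftIco_coe_apply (a := -1 / 2) (f := G)
      ⟨by linarith [hx.1], by linarith [hx.2]⟩).trans ?_
    simp [G, cutoff_eq_one hx]
  rw [hFx, hco] at h
  convert h using 1
  funext n
  rw [smul_eq_mul, fourier_coe_apply]
  congr 2
  push_cast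
  ring

/-- The continuous representative of `f`, on the whole of `[-1/2, 3/2]`. Here `1 ≤ s` matters: for
`s = 0` the extension is merely square integrable. -/
theorem exists_representative {s : ℕ} (hs : 1 ≤ s) (f : HSobolev s) :
    ∃ u : ℝ → ℝ, ContinuousOn u (Icc (-1 / 2) (3 / 2)) ∧ u =ᵐ[volΩ] HSobolev.toL2 f ∧
      extension s s f =ᵐ[volP] u := by
  obtain ⟨r, rfl⟩ : ∃ r, s = r + 1 := ⟨s - 1, by omega⟩
  obtain ⟨κ, -, h⟩ := extension_succ_ae (r + 1) r f
  refine ⟨_, continuousOn_const.add (continuousOn_primitive _), ?_, h⟩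
  have h2 := extension_ae (r + 1) (r + 1) le_rfl f
  have h3 : HSobolev.derivCLM (r + 1) (r + 1 - (r + 1)) f = HSobolev.toL2 f := by
    simp [HSobolev.derivCLM, HSobolev.toL2]
  rw [h3] at h2
  exact Filter.EventuallyEq.trans (Filter.EventuallyEq.symm (ae_volΩ_of_volP h)) h2

theorem exists_sobolev_error (s : ℕ) : ∃ C : ℝ, 0 < C ∧ ∀ m : ℕ, 1 ≤ m → 1 ≤ s →
    ∀ f : HSobolev s, ∃ u : ℝ → ℝ, ContinuousOn u (Icc 0 1) ∧ u =ᵐ[volΩ] HSobolev.toL2 f ∧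
      ∀ x ∈ Icc (0 : ℝ) 1, |u x - ∑ n : Fin m, (sobolevCoeff s m f ⟨n, by omega⟩ *
        Complex.exp (Complex.I * (Real.pi * (n : ℕ) * x : ℝ))).re| ≤
        C * (m : ℝ) ^ ((1 : ℝ) / 2 - s) * ‖f‖ := by
  obtain ⟨C, hC, hdec⟩ := exists_sobolev_decay s
  refine ⟨4 * √C + 1, by positivity, fun m hm hs f => ?_⟩
  obtain ⟨u, hu, hu1, hu2⟩ := exists_representative hs f
  refine ⟨u, hu.mono fun x hx => ⟨by linarith [hx.1], by linarith [hx.2]⟩, hu1, fun x hx => ?_⟩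
  have hB : ∀ A : Finset ℤ, ∑ n ∈ A, (n : ℝ) ^ (2 * s) * ‖fourierCut cutoff u n‖ ^ 2 ≤
      (√C * ‖f‖) ^ 2 := fun A => by
    rw [mul_pow, Real.sq_sqrt hC]
    simpa only [fourierCut_congr _ hu2] using hdec f A
  have h := abs_sub_partialSum_le hs hm (by positivity) hB (fourierCut_neg cutoff u)
    (hasSum_fourierCut hu (summable_of_decay hs hB) hx)
  rw [Finset.sum_range] at h
  have e : ∀ n : Fin m, (sobolevCoeff s m f ⟨n, by omega⟩ *
      Complex.exp (Complex.I * (Real.pi * (n : ℕ) * x : ℝ))).re =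
      ((if (n : ℕ) = 0 then 1 else 2) * fourierCut cutoff u (n : ℕ) *
      Complex.exp (Complex.I * (Real.pi * ((n : ℕ) : ℤ) * x : ℝ))).re := fun n => by
    rw [sobolevCoeff_apply, fourierCut_congr _ hu2, Int.cast_natCast]
  simp only [e]
  refine h.trans ?_
  have : 0 ≤ (m : ℝ) ^ ((1 : ℝ) / 2 - s) * ‖f‖ := by positivity
  nlinarith

theorem coeffOf_complexEmbed {m : ℕ} (z : Fin (2 * m + 1) → ℂ) (n : Fin m) :
    coeffOf (complexEmbed z) n = z ⟨n, by omega⟩ := rfl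

end

theorem theorem1 :
    ∃ C : ℝ, 0 < C ∧
    ∃ c : ℕ → ℝ, (∀ s, 0 < c s) ∧
    ∃ T : (s m : ℕ) → HSobolev s →L[ℝ] (Fin (2 * m + 1) → ℂ),
    ∀ (k m : ℕ) (h : ℝ), 1 ≤ k → 1 ≤ m → h = (1 / 2 : ℝ) ^ k →
      ∃ Ψ : CNN 4 (2 * m + 1) 1 (2 ^ k + 1),
        Ψ.IsLinear ∧
        (Ψ.depth : ℝ) ≤ C * Real.log (1 / h) ∧
        (Ψ.activeWeights : ℝ) ≤ C * m * Real.log (1 / h) ∧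
        (∀ L ∈ Ψ.convLayers, L.inCh ≤ 8 * m ∧ L.outCh ≤ 8 * m) ∧
        (∀ L ∈ Ψ.convLayers, L.groups = m ∨ L.outCh ≤ 8) ∧
        ((Ψ.convLayers.countP (fun L => L.groups ≠ m) : ℕ) : ℝ) ≤ C ∧
        ∀ s : ℕ, 1 ≤ s → ∀ f : HSobolev s,
          ∃ u : ℝ → ℝ, ContinuousOn u (Set.Icc 0 1) ∧
            (u =ᵐ[volΩ] HSobolev.toL2 f) ∧
            ∀ j : Fin (2 ^ k + 1),
              |u (j * h) - Ψ.eval (complexEmbed (T s m f)) 0 j| ≤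
                c s * (m : ℝ) ^ ((1 : ℝ) / 2 - s) * ‖f‖ := by
  choose c hc herr using exists_sobolev_error
  refine ⟨100, by norm_num, c, hc, sobolevCoeff, ?_⟩
  rintro k m h hk hm rfl
  obtain ⟨Ψ, h1, h2, h3, ⟨L, S₀, S₁, h4, h5, h6⟩, h7⟩ :=
    exists_network m k hm (fun n => Real.pi * (n : ℕ) * (1 / 2 : ℝ) ^ k)
  have hlog : (k : ℝ) / 2 ≤ Real.log (1 / (1 / 2 : ℝ) ^ k) := by
    rw [one_div_pow, one_div_one_div, Real.log_pow]
    nlinarith [Real.log_two_gt_d9, (Nat.cast_nonneg k : (0 : ℝ) ≤ k)]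
  have hk' : (1 : ℝ) ≤ k := by exact_mod_cast hk
  have hm' : (1 : ℝ) ≤ m := by exact_mod_cast hm
  refine ⟨Ψ, h1, ?_, ?_, ?_, ?_, ?_, fun s hs f => ?_⟩
  · rw [h2]
    push_cast
    linarith
  · have h3' : (Ψ.activeWeights : ℝ) ≤ 34 * m + k * (8 * m) := by exact_mod_cast h3
    have h8 : (m : ℝ) * (k / 2) ≤ m * Real.log (1 / (1 / 2 : ℝ) ^ k) := by gcongr
    nlinarith
  · intro S hS
    rw [h4] at hS
    simp only [List.mem_cons, List.mem_append, List.not_mem_nil, or_false] at hS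
    rcases hS with rfl | hS | rfl
    · exact ⟨(h6 _ (by simp)).1, (h6 _ (by simp)).2.1⟩
    · exact (h5 S hS).2
    · exact ⟨(h6 _ (by simp)).1, (h6 _ (by simp)).2.1⟩
  · intro S hS
    rw [h4] at hS
    simp only [List.mem_cons, List.mem_append, List.not_mem_nil, or_false] at hS
    rcases hS with rfl | hS | rfl
    · exact Or.inr (h6 _ (by simp)).2.2
    · exact Or.inl (h5 S hS).1
    · exact Or.inr (h6 _ (by simp)).2.2
  · have hL : L.countP (fun S => S.groups ≠ m) = 0 := by
      rw [List.countP_eq_zero]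
      intro S hS
      simp [(h5 S hS).1]
    have : Ψ.convLayers.countP (fun S => S.groups ≠ m) ≤ 2 := by
      rw [h4, List.countP_cons, List.countP_append, hL, List.countP_singleton]
      split_ifs <;> omega
    have h8 : ((Ψ.convLayers.countP (fun S => S.groups ≠ m) : ℕ) : ℝ) ≤ 2 := by exact_mod_cast this
    linarith
  · obtain ⟨u, hu1, hu2, hu3⟩ := herr s m hm hs f
    refine ⟨u, hu1, hu2, fun j => ?_⟩
    have hpow : (0 : ℝ) < (1 / 2 : ℝ) ^ k := by positivity
    have hj : (j : ℝ) * (1 / 2 : ℝ) ^ k ∈ Icc (0 : ℝ) 1 := by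
      refine ⟨by positivity, ?_⟩
      have hj1 : ((j : ℕ) : ℝ) ≤ 2 ^ k := by exact_mod_cast Nat.lt_succ_iff.1 j.isLt
      calc (j : ℝ) * (1 / 2 : ℝ) ^ k ≤ 2 ^ k * (1 / 2 : ℝ) ^ k := by gcongr
        _ = 1 := by rw [← mul_pow]; norm_num
    have h8 := hu3 _ hj
    rw [h7]
    simp only [coeffOf_complexEmbed, wave, Matrix.cons_val_zero]
    simp only [mul_assoc] at h8 ⊢
    simp only [mul_comm ((1 / 2 : ℝ) ^ k) _] at h8 ⊢
    exact h8
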